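/- **Setting.** Let $(\Omega,\mathcal F,P)$ be a probability space, $\mathbb K\in\{\mathbb R,\mathbb C\}$, $L^0(\mathcal F,\mathbb K)$ the algebra of $P$-equivalence classes of $\mathbb K$-valued random variables, $L^0(\mathcal F)=L^0(\mathcal F,\mathbb R)$ with the order $\xi\le\eta$ iff $\xi(\omega)\le\eta(\omega)$ a.s., and $L^0_+(\mathcal F)=\{\xi\in L^0(\mathcal F):\xi\ge 0\}$. A *random normed (RN) module* over $\mathbb K$ with base $(\Omega,\mathcal F,P)$ is an $L^0(\mathcal F,\mathbb K)$-module $E$ with a map $\|\cdot\|:E\to L^0_+(\mathcal F)$ such that $\|x\|=0$ implies $x=\theta$ (the null element), $\|\xi x\|=|\xi|\,\|x\|$ and $\|x+y\|\le\|x\|+\|y\|$ for all $\xi\in L^0(\mathcal F,\mathbb K)$ and $x,y\in E$. Its *$(\varepsilon,\lambda)$-topology* is the linear topology with local base at $\theta$ the sets $\{x\in E: P\{\|x\|<\varepsilon\}>1-\lambda\}$, $\varepsilon>0$, $0<\lambda<1$; "complete", "closed" and "converges" refer to it unless another topology is named. $E$ has *full support* if $\bigvee\{\|x\|:x\in E\}=+\infty$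 a.s., the supremum being taken among classes of extended real valued random variables. The *random conjugate space* $E^*$ is the set of continuous $L^0(\mathcal F,\mathbb K)$-module homomorphisms $E\to L^0(\mathcal F,\mathbb K)$, where $L^0(\mathcal F,\mathbb K)$ is the RN module with $L^0$-norm $|\cdot|$. The *random weak topology* $\sigma(E,E^*)$ is the linear topology on $E$ whose local base at $\theta$ consists of the finite intersections of the sets $\{x\in E: P\{|g(x)|<\varepsilon\}>1-\lambda\}$, $g\in E^*$, $\varepsilon>0$, $0<\lambda<1$. A complete RN module $E$ is *random uniformly convex* if for each $\varepsilon\in L^0(\mathcal F)$ with $l\le\varepsilon\le 2$ for some real $l>0$ there is $\delta\in L^0(\mathcal F)$ with $\eta\le\delta\le1$ for some real $\eta>0$ such that, for all $x,y\in E$ with $\|x\|\le1$, $\|y\|\le1$ and all $D\in\mathcal F$ with $P(D)>0$ on which a.s. $\|x\|\neq0$, $\|y\|\ne0$ and $\|x-y\|\ne0$: if $\|x-y\|\ge\varepsilon$ a.s. on $D$, then $\|x+y\|\le2(1-\delta)$ a.s. on $D$. A nonempty $G\subseteq E$ is *$L^0$-convex* if $\xi x+\eta y\in G$ whenever $x,y\in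 G$, $\xi,\eta\in L^0_+(\mathcal F)$ and $\xi+\eta=1$; it is *a.s. bounded* if there is $\xi\in L^0_+(\mathcal F)$ with $\|x\|\le\xi$ for all $x\in G$. A map $f:G\to G$ is *random asymptotically nonexpansive* if there are $\eta_m\in L^0_+(\mathcal F)$, $m\ge1$, with $\eta_m\to1$ a.s. and $\|f^m x-f^m y\|\le\eta_m\|x-y\|$ for all $x,y\in G$ and all $m\ge1$. **Theorem 2.4.** Let $E$ be a complete random uniformly convex RN module over $\mathbb K$ with base $(\Omega,\mathcal F,P)$ that has full support, $G$ an a.s. bounded closed $L^0$-convex subset of $E$, and $f:G\to G$ a random asymptotically nonexpansive mapping. Then $I-f$ is random demiclosed at $\theta$: for every sequence $(x_n)_{n\in\mathbb N}$ in $G$ and every $x\in E$, if $x_n\to x$ in $\sigma(E,E^*)$ and $x_n-f(x_n)\to\theta$ in the $(\varepsilon,\lambda)$-topology, then $x\in G$ and $f(x)=x$. -/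

import Mathlib

open MeasureTheory Filter Topology

namespace RandomNormed

universe u v w

section L0

variable {Ω : Type u} [MeasurableSpace Ω]

/-- `L0 P β` is the set of `P`-equivalence classes of `β`-valued random variables. -/
abbrev L0 (P : Measure Ω) (β : Type v) [TopologicalSpace β] : Type (max u v) := Ω →ₘ[P] β

variable {P : Measure Ω} {𝕜 : Type v} [RCLike 𝕜]

/-- The algebra structure of `L⁰(F, 𝕜)`, with the pointwise operations of Mathlib. -/
noncomputable instance instCommRingL0 : CommRing (Ω →ₘ[P] 𝕜) :=
  { (AEEqFun.instAddCommGroup : AddCommGroup (Ω →ₘ[P] 𝕜)),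
    (AEEqFun.instCommMonoid : CommMonoid (Ω →ₘ[P] 𝕜)) with
    left_distrib := by
      intro a b c
      apply AEEqFun.ext
      filter_upwards [AEEqFun.coeFn_mul a (b + c), AEEqFun.coeFn_add b c,
        AEEqFun.coeFn_add (a * b) (a * c), AEEqFun.coeFn_mul a b, AEEqFun.coeFn_mul a c]
        with ω h1 h2 h3 h4 h5
      simp only [Pi.mul_apply, Pi.add_apply] at *
      rw [h1, h2, h3, h4, h5, mul_add]
    right_distrib := by
      intro a b c
      apply AEEqFun.ext
      filter_upwards [AEEqFun.coeFn_mul (a + b) c, AEEqFun.coeFn_add a b,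
        AEEqFun.coeFn_add (a * c) (b * c), AEEqFun.coeFn_mul a c, AEEqFun.coeFn_mul b c]
        with ω h1 h2 h3 h4 h5
      simp only [Pi.mul_apply, Pi.add_apply] at *
      rw [h1, h2, h3, h4, h5, add_mul]
    zero_mul := by
      intro a
      apply AEEqFun.ext
      filter_upwards [AEEqFun.coeFn_mul 0 a, AEEqFun.coeFn_zero (μ := P) (β := 𝕜)] with ω h1 h2
      simp only [Pi.mul_apply, Pi.zero_apply] at *
      rw [h1, h2, zero_mul]
    mul_zero := by
      intro a
      apply AEEqFun.ext
      filter_upwards [AEEqFun.coeFn_mul a 0, AEEqFun.coeFn_zero (μ := P) (β := 𝕜)] with ω h1 h2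
      simp only [Pi.mul_apply, Pi.zero_apply] at *
      rw [h1, h2, mul_zero] }

/-- The absolute value `|ξ| ∈ L⁰₊(F)` of `ξ ∈ L⁰(F, 𝕜)`. -/
noncomputable def L0abs (ξ : L0 P 𝕜) : L0 P ℝ :=
  AEEqFun.comp (fun z : 𝕜 => ‖z‖) continuous_norm ξ

/-- The inclusion of `L⁰(F) = L⁰(F, ℝ)` in `L⁰(F, 𝕜)`. -/
noncomputable def L0ofReal (𝕜 : Type v) [RCLike 𝕜] (ξ : L0 P ℝ) : L0 P 𝕜 :=
  AEEqFun.comp (fun r : ℝ => (r : 𝕜)) RCLike.continuous_ofReal ξ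

/-- The inclusion of `L⁰(F)` in the extended real valued classes. -/
noncomputable def L0toEReal (ξ : L0 P ℝ) : L0 P EReal :=
  AEEqFun.comp (fun r : ℝ => (r : EReal)) continuous_coe_real_ereal ξ

theorem coeFn_L0abs (ξ : L0 P 𝕜) : ∀ᵐ ω ∂P, L0abs ξ ω = ‖ξ ω‖ :=
  AEEqFun.coeFn_comp _ _ _

end L0

/-- A random normed module over `𝕜` with base `(Ω, F, P)`: an `L⁰(F, 𝕜)`-module `E` with an
`L⁰`-norm `rnorm : E → L⁰₊(F)`. -/
class RNModule {Ω : Type u} [MeasurableSpace Ω] (P : Measure Ω) (𝕜 : Type v) [RCLike 𝕜]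
    (E : Type w) [AddCommGroup E] [Module (Ω →ₘ[P] 𝕜) E] where
  rnorm : E → Ω →ₘ[P] ℝ
  rnorm_nonneg : ∀ x, 0 ≤ rnorm x
  eq_zero_of_rnorm : ∀ x, rnorm x = 0 → x = 0
  rnorm_smul : ∀ (ξ : Ω →ₘ[P] 𝕜) (x : E), rnorm (ξ • x) = L0abs ξ * rnorm x
  rnorm_add_le : ∀ x y, rnorm (x + y) ≤ rnorm x + rnorm y

section Topologies

variable {Ω : Type u} [MeasurableSpace Ω] (P : Measure Ω) (𝕜 : Type v) [RCLike 𝕜]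

/-- `(L⁰(F, 𝕜), |·|)` as a random normed module. -/
noncomputable instance instRNModuleL0 : RNModule P 𝕜 (Ω →ₘ[P] 𝕜) where
  rnorm := L0abs
  rnorm_nonneg := by
    intro x
    rw [← AEEqFun.coeFn_le]
    filter_upwards [coeFn_L0abs x, AEEqFun.coeFn_zero (μ := P) (β := ℝ)] with ω h1 h2
    rw [h1, h2]
    exact norm_nonneg _
  eq_zero_of_rnorm := by
    intro x hx
    apply AEEqFun.ext
    have h0 := coeFn_L0abs x
    rw [hx] at h0
    filter_upwards [h0, AEEqFun.coeFn_zero (μ := P) (β := ℝ),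
      AEEqFun.coeFn_zero (μ := P) (β := 𝕜)] with ω h1 h2 h3
    rw [h2] at h1
    rw [h3]
    exact norm_eq_zero.1 h1.symm
  rnorm_smul := by
    intro ξ x
    apply AEEqFun.ext
    filter_upwards [coeFn_L0abs (ξ • x), coeFn_L0abs ξ, coeFn_L0abs x,
      AEEqFun.coeFn_mul (L0abs ξ) (L0abs x), AEEqFun.coeFn_mul ξ x] with ω h1 h2 h3 h4 h5
    rw [smul_eq_mul] at h1 ⊢
    rw [h1, h4, h5, Pi.mul_apply, Pi.mul_apply, h2, h3, norm_mul]
  rnorm_add_le := by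
    intro x y
    rw [← AEEqFun.coeFn_le]
    filter_upwards [coeFn_L0abs (x + y), coeFn_L0abs x, coeFn_L0abs y,
      AEEqFun.coeFn_add (L0abs x) (L0abs y), AEEqFun.coeFn_add x y] with ω h1 h2 h3 h4 h5
    rw [h1, h4, h5, Pi.add_apply, Pi.add_apply, h2, h3]
    exact norm_add_le _ _

variable {E : Type w} [AddCommGroup E] [Module (Ω →ₘ[P] 𝕜) E] [RNModule P 𝕜 E]

/-- The `L⁰`-norm of `x`. -/
def rnorm (x : E) : Ω →ₘ[P] ℝ := RNModule.rnorm 𝕜 x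

theorem rnorm_neg (x : E) : rnorm P 𝕜 (-x) = rnorm P 𝕜 x := by
  have h := RNModule.rnorm_smul (P := P) (𝕜 := 𝕜) (-1) x
  have h1 : L0abs (-1 : Ω →ₘ[P] 𝕜) = 1 := by
    apply AEEqFun.ext
    filter_upwards [coeFn_L0abs (-1 : Ω →ₘ[P] 𝕜), AEEqFun.coeFn_neg (1 : Ω →ₘ[P] 𝕜),
      AEEqFun.coeFn_one (μ := P) (β := 𝕜), AEEqFun.coeFn_one (μ := P) (β := ℝ)] with ω a b c d
    rw [a, b, d, Pi.neg_apply, c]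
    simp
  rw [h1, one_mul, neg_smul, one_smul] at h
  exact h

theorem rnorm_zero : rnorm P 𝕜 (0 : E) = 0 := by
  have h := RNModule.rnorm_smul (P := P) (𝕜 := 𝕜) 0 (0 : E)
  have h1 : L0abs (0 : Ω →ₘ[P] 𝕜) = 0 := by
    apply AEEqFun.ext
    filter_upwards [coeFn_L0abs (0 : Ω →ₘ[P] 𝕜),
      AEEqFun.coeFn_zero (μ := P) (β := 𝕜), AEEqFun.coeFn_zero (μ := P) (β := ℝ)] with ω a c d
    rw [a, c, d]
    simp
  rw [h1, zero_mul, smul_zero] at h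
  exact h

/-- `N_θ(ε, lam) = {x | P {ω | ‖x‖(ω) < ε} > 1 - lam}`. -/
def epsLamNhd (E : Type w) [AddCommGroup E] [Module (Ω →ₘ[P] 𝕜) E] [RNModule P 𝕜 E]
    (ε lam : ℝ) : Set E :=
  {x | 1 - lam < P.real {ω | rnorm P 𝕜 x ω < ε}}

theorem epsLamNhd_mono {ε ε' lam lam' : ℝ} (hε : ε ≤ ε') (hl : lam ≤ lam')
    [IsProbabilityMeasure P] : epsLamNhd P 𝕜 E ε lam ⊆ epsLamNhd P 𝕜 E ε' lam' := by
  intro x hx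
  have h : P.real {ω | rnorm P 𝕜 x ω < ε} ≤ P.real {ω | rnorm P 𝕜 x ω < ε'} :=
    measureReal_mono fun ω hω => lt_of_lt_of_le hω hε
  simp only [epsLamNhd, Set.mem_ofPred_eq] at hx ⊢
  linarith

theorem add_mem_epsLamNhd {ε lam : ℝ} [IsProbabilityMeasure P] {x y : E}
    (hx : x ∈ epsLamNhd P 𝕜 E (ε / 2) (lam / 2)) (hy : y ∈ epsLamNhd P 𝕜 E (ε / 2) (lam / 2)) :
    x + y ∈ epsLamNhd P 𝕜 E ε lam := by
  simp only [epsLamNhd, Set.mem_ofPred_eq] at hx hy ⊢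
  have hm : MeasurableSet {ω | rnorm P 𝕜 y ω < ε / 2} :=
    measurableSet_lt (rnorm P 𝕜 y).measurable measurable_const
  have h1 := measureReal_union_add_inter (μ := P) (s := {ω | rnorm P 𝕜 x ω < ε / 2}) hm
  have h2 : P.real ({ω | rnorm P 𝕜 x ω < ε / 2} ∪ {ω | rnorm P 𝕜 y ω < ε / 2}) ≤ 1 :=
    measureReal_le_one
  have h3 : P.real ({ω | rnorm P 𝕜 x ω < ε / 2} ∩ {ω | rnorm P 𝕜 y ω < ε / 2}) ≤
      P.real {ω | rnorm P 𝕜 (x + y) ω < ε} := by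
    refine ENNReal.toReal_mono (measure_ne_top _ _) (measure_mono_ae ?_)
    filter_upwards [AEEqFun.coeFn_le.2 (RNModule.rnorm_add_le (P := P) (𝕜 := 𝕜) x y),
      AEEqFun.coeFn_add (RNModule.rnorm (P := P) 𝕜 x) (RNModule.rnorm (P := P) 𝕜 y)]
      with ω a b
    rintro ⟨c, d⟩
    rw [b, Pi.add_apply] at a
    have c' : RNModule.rnorm (P := P) 𝕜 x ω < ε / 2 := c
    have d' : RNModule.rnorm (P := P) 𝕜 y ω < ε / 2 := d
    have : RNModule.rnorm (P := P) 𝕜 (x + y) ω < ε := by linarith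
    exact this
  linarith

/-- The sets `N_θ(ε, lam)`, `ε > 0`, `0 < lam < 1`, as a local base at the null element. -/
@[reducible] noncomputable def epsLamBasis (E : Type w) [AddCommGroup E] [Module (Ω →ₘ[P] 𝕜) E] [RNModule P 𝕜 E]
    [IsProbabilityMeasure P] : AddGroupFilterBasis E :=
  addGroupFilterBasisOfComm
    {U | ∃ ε lam : ℝ, 0 < ε ∧ 0 < lam ∧ lam < 1 ∧ U = epsLamNhd P 𝕜 E ε lam}
    ⟨_, 1, 1 / 2, by norm_num, by norm_num, by norm_num, rfl⟩
    (by
      rintro _ _ ⟨ε, l, hε, hl, hl1, rfl⟩ ⟨ε', l', hε', hl', hl1', rfl⟩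
      exact ⟨_, ⟨min ε ε', min l l', lt_min hε hε', lt_min hl hl', lt_of_le_of_lt (min_le_left _ _)
        hl1, rfl⟩, Set.subset_inter (epsLamNhd_mono P 𝕜 (min_le_left _ _) (min_le_left _ _))
        (epsLamNhd_mono P 𝕜 (min_le_right _ _) (min_le_right _ _))⟩)
    (by
      rintro _ ⟨ε, l, hε, hl, hl1, rfl⟩
      have h : P.real {ω | rnorm P 𝕜 (0 : E) ω < ε} = 1 := by
        have h0 : {ω | rnorm P 𝕜 (0 : E) ω < ε} =ᵐ[P] (Set.univ : Set Ω) := by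
          rw [eventuallyEq_univ, rnorm_zero]
          filter_upwards [AEEqFun.coeFn_zero (μ := P) (β := ℝ)] with ω h
          simpa [h] using hε
        rw [measureReal_congr h0, probReal_univ]
      simp only [epsLamNhd, Set.mem_ofPred_eq]
      rw [h]
      linarith)
    (by
      rintro _ ⟨ε, l, hε, hl, hl1, rfl⟩
      refine ⟨_, ⟨ε / 2, l / 2, by linarith, by linarith, by linarith, rfl⟩, ?_⟩
      rintro _ ⟨x, hx, y, hy, rfl⟩
      exact add_mem_epsLamNhd P 𝕜 hx hy)
    (by
      rintro _ ⟨ε, l, hε, hl, hl1, rfl⟩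
      refine ⟨_, ⟨ε, l, hε, hl, hl1, rfl⟩, ?_⟩
      intro x hx
      simp only [epsLamNhd, Set.mem_ofPred_eq, Set.mem_preimage, rnorm_neg] at hx ⊢
      exact hx)

/-- The `(ε, lam)`-topology of a random normed module. -/
@[reducible] noncomputable def epsLamTopology (E : Type w) [AddCommGroup E] [Module (Ω →ₘ[P] 𝕜) E] [RNModule P 𝕜 E]
    [IsProbabilityMeasure P] : TopologicalSpace E :=
  (epsLamBasis P 𝕜 E).topology

/-- Completeness for the `(ε, lam)`-topology. This linear topology is metrizable, so completeness
means that Cauchy sequences converge. -/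
def IsCompleteRN (E : Type w) [AddCommGroup E] [Module (Ω →ₘ[P] 𝕜) E] [RNModule P 𝕜 E]
    [IsProbabilityMeasure P] : Prop :=
  ∀ u : ℕ → E,
    (∀ ε lam : ℝ, 0 < ε → 0 < lam → lam < 1 →
      ∃ N, ∀ m ≥ N, ∀ n ≥ N, u m - u n ∈ epsLamNhd P 𝕜 E ε lam) →
    ∃ x, Tendsto u atTop (@nhds E (epsLamTopology P 𝕜 E) x)

/-- The random conjugate space `E*`: continuous `L⁰(F, 𝕜)`-module homomorphisms from `E` to
`L⁰(F, 𝕜)`, both with their `(ε, lam)`-topologies. -/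
noncomputable def RandomDual (E : Type w) [AddCommGroup E] [Module (Ω →ₘ[P] 𝕜) E] [RNModule P 𝕜 E]
    [IsProbabilityMeasure P] : Type (max u v w) :=
  {g : E →ₗ[Ω →ₘ[P] 𝕜] (Ω →ₘ[P] 𝕜) //
    Continuous[epsLamTopology P 𝕜 E, epsLamTopology P 𝕜 (Ω →ₘ[P] 𝕜)] g}

/-- The random weak topology `σ(E, E*)`: the coarsest topology for which every `g ∈ E*` is
continuous into `L⁰(F, 𝕜)` with its `(ε, lam)`-topology. A local base at the null element consists
of the finite intersections of the sets `{x | P {ω | |g x|(ω) < ε} > 1 - lam}`. -/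
@[reducible] noncomputable def randomWeakTopology (E : Type w) [AddCommGroup E] [Module (Ω →ₘ[P] 𝕜) E] [RNModule P 𝕜 E]
    [IsProbabilityMeasure P] : TopologicalSpace E :=
  ⨅ g : RandomDual P 𝕜 E, TopologicalSpace.induced g.1 (epsLamTopology P 𝕜 (Ω →ₘ[P] 𝕜))

/-- Full support: the supremum of `{‖x‖ | x ∈ E}` among the extended real valued classes is
`+∞` almost surely. -/
def HasFullSupport (E : Type w) [AddCommGroup E] [Module (Ω →ₘ[P] 𝕜) E] [RNModule P 𝕜 E] : Prop :=
  IsLUB (Set.range fun x : E => L0toEReal (rnorm P 𝕜 x)) (AEEqFun.const Ω (⊤ : EReal))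

/-- Random uniform convexity. The condition on `D` says that `D` has positive probability and is
almost surely contained in the supports of `x`, `y` and `x - y`. -/
def IsRandomUniformlyConvex (E : Type w) [AddCommGroup E] [Module (Ω →ₘ[P] 𝕜) E]
    [RNModule P 𝕜 E] : Prop :=
  ∀ ε : Ω →ₘ[P] ℝ, (∃ l : ℝ, 0 < l ∧ ∀ᵐ ω ∂P, l ≤ ε ω ∧ ε ω ≤ 2) →
    ∃ δ : Ω →ₘ[P] ℝ, (∃ η : ℝ, 0 < η ∧ ∀ᵐ ω ∂P, η ≤ δ ω ∧ δ ω ≤ 1) ∧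
      ∀ x y : E, rnorm P 𝕜 x ≤ 1 → rnorm P 𝕜 y ≤ 1 →
        ∀ D : Set Ω, MeasurableSet D → 0 < P D →
          (∀ᵐ ω ∂P, ω ∈ D → rnorm P 𝕜 x ω ≠ 0 ∧ rnorm P 𝕜 y ω ≠ 0 ∧ rnorm P 𝕜 (x - y) ω ≠ 0) →
          (∀ᵐ ω ∂P, ω ∈ D → ε ω ≤ rnorm P 𝕜 (x - y) ω) →
          ∀ᵐ ω ∂P, ω ∈ D → rnorm P 𝕜 (x + y) ω ≤ 2 * (1 - δ ω)

/-- Almost sure boundedness of `G`: the norms of its elements have an upper bound in `L⁰(F)`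
(equivalently, as `L⁰(F)` is Dedekind complete, a supremum there). -/
def IsASBounded (G : Set E) : Prop := BddAbove (rnorm P 𝕜 '' G)

/-- `L⁰`-convexity of a (by convention nonempty) set. -/
def IsL0Convex (G : Set E) : Prop :=
  G.Nonempty ∧ ∀ x ∈ G, ∀ y ∈ G, ∀ ξ η : Ω →ₘ[P] ℝ, 0 ≤ ξ → 0 ≤ η → ξ + η = 1 →
    L0ofReal 𝕜 ξ • x + L0ofReal 𝕜 η • y ∈ G

/-- Random asymptotically nonexpansive self-mappings of `G`. -/
def IsRandomAsymptoticallyNonexpansive {G : Set E} (f : G → G) : Prop :=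
  ∃ η : ℕ → Ω →ₘ[P] ℝ, (∀ m ≥ 1, 0 ≤ η m) ∧
    (∀ᵐ ω ∂P, Tendsto (fun m => η m ω) atTop (𝓝 1)) ∧
    ∀ m ≥ 1, ∀ x y : G, rnorm P 𝕜 ((f^[m] x : E) - f^[m] y) ≤ η m * rnorm P 𝕜 ((x : E) - y)

/-- `T : G → E` is random demiclosed at the null element: if a sequence in `G` converges to
`x ∈ E` in `σ(E, E*)` and its image under `T` converges to `0` in the `(ε, lam)`-topology, then
`x` lies in `G` and `T x = 0`. -/
def IsRandomDemiclosedAtZero [IsProbabilityMeasure P] {G : Set E} (T : G → E) : Prop :=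
  ∀ (u : ℕ → G) (x : E),
    Tendsto (fun n => (u n : E)) atTop (@nhds E (randomWeakTopology P 𝕜 E) x) →
    Tendsto (fun n => T (u n)) atTop (@nhds E (epsLamTopology P 𝕜 E) 0) →
    ∃ hx : x ∈ G, T ⟨x, hx⟩ = 0

end Topologies

end RandomNormed

open RandomNormed

/-!
The proof reduces the random statement to the demiclosedness principle in a seminormed space that
satisfies an approximate parallelogram law (`ApproxParallelogram`, a form of uniform convexity
that survives integration).

*Reduction.* For a measurable set `A` let `L2Space P 𝕜 E A` be the space of all `y` in `E` with
`∫_A ‖y‖² dP < ∞`. Random uniform convexity gives the approximate parallelogram law almost surely,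
with deterministic constants (`IsRandomUniformlyConvex.ae_approxParallelogram`), and integrating it
gives the same law for `L2Space`. By Egorov's theorem the complement of `A` can be made as small as
desired while, on `A`, the set `G` is bounded by a constant and the Lipschitz factors of the
iterates of `f` tend to `1` uniformly. So `f` is asymptotically nonexpansive in the usual sense for
the seminorm of `L2Space`.

*Duality.* A continuous functional `φ` on `L2Space` is of the form `φ (h • y) = ∫ h * g y` with `g`
in the random conjugate space: for fixed `y` the density `g y` comes from the Riesz representation
theorem in `L²(P, 𝕜)`, uniqueness of densities makes `g` a module homomorphism, and the bound on
`φ` makes it continuous in probability. Hence random weak convergence of a bounded sequence implies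
weak convergence in `L2Space` (`weaklyTendsto_of_tendsto_randomWeak`).

*Demiclosedness.* Let `u n → x` weakly with `u n - f (u n) → 0`. By uniform convexity and weak
lower semicontinuity of the norm, the midpoints of `v i` and a suitable later `v (j i)` are closer
to `x` by a fixed factor (Kakutani's halving argument, `ApproxParallelogram.exists_contraction`).
Being almost fixed by all large iterates `f^[m]` passes to midpoints
(`AsymptoticallyFixed.midpoint`). Repeating this finitely often gives sequences in `G` as close to
`x` as desired that are still almost fixed by the large iterates. So `x` is in the closure of `G`,
and `f^[m] x → x`, whence `f x = x`. Halving a bounded number of times replaces Bruck's estimate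
for convex combinations of arbitrary length.
-/

namespace RandomNormed

/-! ### Demiclosedness in seminormed spaces with an approximate parallelogram law -/

/-- Uniform convexity in the form of an approximate parallelogram law: the defect in the
parallelogram law controls `‖x - y‖²` up to a small multiple of `‖x‖² + ‖y‖²`. Unlike the usual
modulus of convexity, the inequality is homogeneous and linear in the squared norms, so it can be
integrated. -/
def ApproxParallelogram (X : Type*) [SeminormedAddCommGroup X] : Prop :=
  ∀ ε : ℝ, 0 < ε → ∃ C : ℝ, 0 < C ∧ ∀ x y : X,
    ‖x - y‖ ^ 2 ≤ C * (2 * ‖x‖ ^ 2 + 2 * ‖y‖ ^ 2 - ‖x + y‖ ^ 2) + ε * (‖x‖ ^ 2 + ‖y‖ ^ 2)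

section Deterministic

variable {𝕜 X : Type*} [RCLike 𝕜] [SeminormedAddCommGroup X] [NormedSpace 𝕜 X]

/-- A point `t` that is almost as close to `a` and to `b` as their midpoint `c` is must be close to
`c`. For `t = f^[m] c` this bounds the displacement of the midpoint by those of `a` and `b`. -/
theorem ApproxParallelogram.exists_displacement_bound (hX : ApproxParallelogram X)
    {R : ℝ} (hR : 0 < R) {τ : ℝ} (hτ : 0 < τ) :
    ∃ ρ : ℝ, 0 < ρ ∧ ∀ a b c t : X, c = (2⁻¹ : 𝕜) • (a + b) → ‖a - b‖ ≤ R →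
      ‖t - a‖ ≤ (1 + ρ) * ‖c - a‖ + ρ → ‖t - b‖ ≤ (1 + ρ) * ‖c - b‖ + ρ → ‖t - c‖ ≤ τ := by
  obtain ⟨C, hC, h⟩ := hX (τ ^ 2 / (R + 2) ^ 2) (by positivity)
  have hlim : Tendsto
      (fun ρ : ℝ => C * (4 * R * ρ + ((1 + ρ) ^ 2 - 1) * R ^ 2 + 4 * ρ * (ρ * R + ρ)))
      (𝓝[>] 0) (𝓝 0) := by
    have : Continuous
        (fun ρ : ℝ => C * (4 * R * ρ + ((1 + ρ) ^ 2 - 1) * R ^ 2 + 4 * ρ * (ρ * R + ρ))) := by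
      fun_prop
    have h0 := (this.tendsto 0).mono_left (nhdsWithin_le_nhds (s := Set.Ioi 0))
    simpa using h0
  obtain ⟨ρ, hρ1, hρ2, hρ3⟩ := ((hlim.eventually_le_const (show (0 : ℝ) < τ ^ 2 by positivity)).and
    ((eventually_mem_nhdsWithin).and (Ioo_mem_nhdsGT (show (0 : ℝ) < 1 by norm_num)))).exists
  have hρ0 : 0 < ρ := hρ2
  refine ⟨ρ, hρ0, fun a b c t hc hab hta htb => ?_⟩
  have h2 : (2 : 𝕜) ≠ 0 := two_ne_zero
  have hca : ‖c - a‖ = ‖a - b‖ / 2 := by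
    have : c - a = (2⁻¹ : 𝕜) • (b - a) := by
      have h3 : a = (2⁻¹ : 𝕜) • (a + a) := by
        rw [← two_smul 𝕜 a, smul_smul, inv_mul_cancel₀ h2, one_smul]
      rw [hc]; nth_rewrite 2 [h3]; rw [← smul_sub]; congr 1; abel
    rw [this, norm_smul, norm_inv, RCLike.norm_ofNat, norm_sub_rev]; ring
  have hcb : ‖c - b‖ = ‖a - b‖ / 2 := by
    have : c - b = (2⁻¹ : 𝕜) • (a - b) := by
      have h3 : b = (2⁻¹ : 𝕜) • (b + b) := by
        rw [← two_smul 𝕜 b, smul_smul, inv_mul_cancel₀ h2, one_smul]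
      rw [hc]; nth_rewrite 2 [h3]; rw [← smul_sub]; congr 1; abel
    rw [this, norm_smul, norm_inv, RCLike.norm_ofNat]; ring
  have hsum : (t - a) + (b - t) = b - a := by abel
  have hdiff : (t - a) - (b - t) = (2 : 𝕜) • (t - c) := by
    rw [smul_sub, hc, smul_smul, mul_inv_cancel₀ h2, one_smul, two_smul]; abel
  -- the sum of `t - a` and `b - t` is `b - a`, their difference is `2 • (t - c)`
  have key := h (t - a) (b - t)
  rw [hsum, hdiff, norm_smul, RCLike.norm_ofNat, norm_sub_rev b t, norm_sub_rev b a] at key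
  set d := ‖a - b‖
  have hd : 0 ≤ d := norm_nonneg _
  rw [hca] at hta
  rw [hcb] at htb
  have hp : ‖t - a‖ ^ 2 ≤ ((1 + ρ) * (d / 2) + ρ) ^ 2 := by gcongr
  have hq : ‖t - b‖ ^ 2 ≤ ((1 + ρ) * (d / 2) + ρ) ^ 2 := by gcongr
  have e1 : 2 * ‖t - a‖ ^ 2 + 2 * ‖t - b‖ ^ 2 - d ^ 2 ≤
      4 * R * ρ + ((1 + ρ) ^ 2 - 1) * R ^ 2 + 4 * ρ * (ρ * R + ρ) := by
    have a1 : ((1 + ρ) ^ 2 - 1) * d ^ 2 ≤ ((1 + ρ) ^ 2 - 1) * R ^ 2 := by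
      have : 0 ≤ (1 + ρ) ^ 2 - 1 := by nlinarith
      gcongr
    have a2 : ρ * d ≤ ρ * R := by gcongr
    have a3 : ρ * (ρ * d) ≤ ρ * (ρ * R) := by gcongr
    nlinarith
  have e2 : ‖t - a‖ ^ 2 + ‖t - b‖ ^ 2 ≤ 2 * (R + 2) ^ 2 := by
    have : ((1 + ρ) * (d / 2) + ρ) ^ 2 ≤ (R + 2) ^ 2 := by
      have : (1 + ρ) * (d / 2) + ρ ≤ R + 2 := by nlinarith [hρ3.2]
      gcongr
    linarith
  have e3 : τ ^ 2 / (R + 2) ^ 2 * (‖t - a‖ ^ 2 + ‖t - b‖ ^ 2) ≤ 2 * τ ^ 2 := by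
    calc _ ≤ τ ^ 2 / (R + 2) ^ 2 * (2 * (R + 2) ^ 2) := by gcongr
      _ = 2 * τ ^ 2 := by field_simp
  have e4 : C * (2 * ‖t - a‖ ^ 2 + 2 * ‖t - b‖ ^ 2 - d ^ 2) ≤ τ ^ 2 :=
    (mul_le_mul_of_nonneg_left e1 hC.le).trans hρ1
  refine le_of_sq_le_sq ?_ hτ.le
  nlinarith [sq_nonneg τ]

/-- Weak convergence of the sequence `v` to `x`. -/
def WeaklyTendsto (𝕜 : Type*) {X : Type*} [RCLike 𝕜] [SeminormedAddCommGroup X] [NormedSpace 𝕜 X]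
    (v : ℕ → X) (x : X) : Prop :=
  ∀ φ : X →L[𝕜] 𝕜, Tendsto (fun n => φ (v n)) atTop (𝓝 (φ x))

/-- Weak lower semicontinuity of the norm. -/
theorem WeaklyTendsto.eventually_lt_norm_sub {v : ℕ → X} {x p : X} (hv : WeaklyTendsto 𝕜 v x)
    {r : ℝ} (hr : r < ‖p - x‖) : ∀ᶠ n in atTop, r < ‖p - v n‖ := by
  obtain ⟨φ, hφ, hφx⟩ := exists_dual_vector'' 𝕜 (p - x)
  have h1 : Tendsto (fun n => ‖φ (p - v n)‖) atTop (𝓝 ‖φ (p - x)‖) := by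
    simp only [map_sub]
    exact ((tendsto_const_nhds).sub (hv φ)).norm
  rw [hφx, RCLike.norm_ofReal, abs_of_nonneg (norm_nonneg _)] at h1
  filter_upwards [h1.eventually_const_lt hr] with n hn
  exact hn.trans_le (φ.le_of_opNorm_le_of_le hφ le_rfl |>.trans (by rw [one_mul]))

/-- Kakutani's halving argument: pairing each term of a weakly convergent sequence with a
suitable later one, the midpoints are closer to the weak limit by a fixed factor `θ < 1`. -/
theorem ApproxParallelogram.exists_contraction (hX : ApproxParallelogram X) :
    ∃ θ : ℝ, 0 < θ ∧ θ < 1 ∧ ∀ (v : ℕ → X) (x : X) (R : ℝ), 0 < R → WeaklyTendsto 𝕜 v x →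
      (∀ᶠ n in atTop, ‖v n - x‖ ≤ R) → ∃ j : ℕ → ℕ, (∀ i, i ≤ j i) ∧
        ∀ᶠ i in atTop, ‖(2⁻¹ : 𝕜) • (v i + v (j i)) - x‖ ≤ θ * R := by
  obtain ⟨C, hC, h⟩ := hX (1 / 16) (by norm_num)
  have hx1 : max 0 (1 - 1 / (32 * C)) < 1 := by
    refine max_lt one_pos ?_
    have : 0 < 1 / (32 * C) := by positivity
    linarith
  refine ⟨max (3 / 4) (√(max 0 (1 - 1 / (32 * C)))), by positivity,
    max_lt (by norm_num) (by rw [Real.sqrt_lt' one_pos, one_pow]; exact hx1), ?_⟩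
  intro v x R hR hv hvR
  have hev : ∀ i, ∃ j, i ≤ j ∧ ‖v j - x‖ ≤ R ∧ (R / 2 < ‖v i - x‖ → R / 2 < ‖v i - v j‖) := by
    intro i
    by_cases hi : R / 2 < ‖v i - x‖
    · obtain ⟨j, h1, h2, h3⟩ :=
        ((eventually_ge_atTop i).and (hvR.and (hv.eventually_lt_norm_sub hi))).exists
      exact ⟨j, h1, h2, fun _ => h3⟩
    · obtain ⟨j, h1, h2⟩ := ((eventually_ge_atTop i).and hvR).exists
      exact ⟨j, h1, h2, fun h => absurd h hi⟩
  choose j hj1 hj2 hj3 using hev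
  refine ⟨j, hj1, ?_⟩
  filter_upwards [hvR] with i hi
  have hmid : ‖(2⁻¹ : 𝕜) • (v i + v (j i)) - x‖ = ‖(v i - x) + (v (j i) - x)‖ / 2 := by
    have : (2⁻¹ : 𝕜) • (v i + v (j i)) - x = (2⁻¹ : 𝕜) • ((v i - x) + (v (j i) - x)) := by
      have h3 : x = (2⁻¹ : 𝕜) • (x + x) := by
        rw [← two_smul 𝕜 x, smul_smul, inv_mul_cancel₀ two_ne_zero, one_smul]
      nth_rewrite 1 [h3]; rw [← smul_sub]; congr 1; abel
    rw [this, norm_smul, norm_inv, RCLike.norm_ofNat]; ring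
  rw [hmid]
  have hj := hj2 i
  by_cases hi2 : R / 2 < ‖v i - x‖
  · have key := h (v i - x) (v (j i) - x)
    have hs := hj3 i hi2
    rw [sub_sub_sub_cancel_right] at key
    set s := ‖(v i - x) + (v (j i) - x)‖
    have hs0 : 0 ≤ s := norm_nonneg _
    have q1 : ‖v i - x‖ ^ 2 ≤ R ^ 2 := by gcongr
    have q2 : ‖v (j i) - x‖ ^ 2 ≤ R ^ 2 := by gcongr
    have q3 : (R / 2) ^ 2 ≤ ‖v i - v (j i)‖ ^ 2 := by gcongr
    have q4 : C * (2 * ‖v i - x‖ ^ 2 + 2 * ‖v (j i) - x‖ ^ 2 - s ^ 2) ≤ C * (4 * R ^ 2 - s ^ 2) := by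
      gcongr; linarith
    have q5 : R ^ 2 / 8 ≤ C * (4 * R ^ 2 - s ^ 2) := by nlinarith
    have q6 : (s / 2) ^ 2 ≤ (1 - 1 / (32 * C)) * R ^ 2 := by
      have : R ^ 2 / 8 / C ≤ 4 * R ^ 2 - s ^ 2 := by rwa [div_le_iff₀ hC, mul_comm]
      have e : (1 - 1 / (32 * C)) * R ^ 2 = R ^ 2 - (R ^ 2 / 8 / C) / 4 := by field_simp; ring
      rw [e]; nlinarith
    have q7 : s / 2 ≤ √(max 0 (1 - 1 / (32 * C))) * R := by
      refine le_of_sq_le_sq ?_ (by positivity)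
      rw [mul_pow, Real.sq_sqrt (le_max_left _ _)]
      exact q6.trans (by gcongr; exact le_max_right _ _)
    exact q7.trans (by gcongr; exact le_max_right _ _)
  · have := norm_add_le (v i - x) (v (j i) - x)
    have q : (3 / 4 : ℝ) * R ≤ max (3 / 4) (√(max 0 (1 - 1 / (32 * C)))) * R := by
      gcongr; exact le_max_left _ _
    linarith

/-- The terms of `v` are almost fixed by the large iterates of `f`: for `m` large enough, the
displacement of `v n` by `f^[m]` is eventually at most `τ`, from an index on that may depend on `m`.
The map `f` acts on an index type `ι`, and `e` places its points in the seminormed space. -/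
def AsymptoticallyFixed {ι X : Type*} [SeminormedAddCommGroup X] (e : ι → X) (f : ι → ι)
    (v : ℕ → ι) : Prop :=
  ∀ τ : ℝ, 0 < τ → ∃ m₀ : ℕ, ∀ m ≥ m₀, ∀ᶠ n in atTop, ‖e (f^[m] (v n)) - e (v n)‖ ≤ τ

theorem asymptoticallyFixed_of_tendsto {ι : Type*} {e : ι → X} {f : ι → ι} {v : ℕ → ι} {L : ℝ}
    (hL : ∀ a b, ‖e (f a) - e (f b)‖ ≤ L * ‖e a - e b‖)
    (hv : Tendsto (fun n => ‖e (v n) - e (f (v n))‖) atTop (𝓝 0)) :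
    AsymptoticallyFixed e f v := by
  have h : ∀ m, Tendsto (fun n => ‖e (f^[m] (v n)) - e (v n)‖) atTop (𝓝 0) := by
    intro m
    induction m with
    | zero => simp
    | succ m ih =>
      have h1 : Tendsto (fun n => L * ‖e (f^[m] (v n)) - e (v n)‖ + ‖e (v n) - e (f (v n))‖)
          atTop (𝓝 0) := by simpa using (ih.const_mul L).add hv
      refine squeeze_zero (fun _ => norm_nonneg _) (fun n => ?_) h1
      rw [Function.iterate_succ_apply']
      calc _ ≤ ‖e (f (f^[m] (v n))) - e (f (v n))‖ + ‖e (f (v n)) - e (v n)‖ :=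
            norm_sub_le_norm_sub_add_norm_sub _ _ _
        _ ≤ _ := by rw [norm_sub_rev (e (f (v n)))]; gcongr; exact hL _ _
  exact fun τ hτ => ⟨0, fun m _ => (h m).eventually_le_const hτ⟩

theorem AsymptoticallyFixed.midpoint {ι : Type*} {e : ι → X} {f : ι → ι} {v w : ℕ → ι} {j : ℕ → ℕ}
    (hX : ApproxParallelogram X) {R : ℝ} (hR : 0 < R) (he : ∀ a b, ‖e a - e b‖ ≤ R)
    (hf : ∀ ρ : ℝ, 0 < ρ → ∃ m₀ : ℕ, ∀ m ≥ m₀, ∀ a b,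
      ‖e (f^[m] a) - e (f^[m] b)‖ ≤ (1 + ρ) * ‖e a - e b‖)
    (hv : AsymptoticallyFixed e f v) (hw : ∀ i, e (w i) = (2⁻¹ : 𝕜) • (e (v i) + e (v (j i))))
    (hj : ∀ i, i ≤ j i) : AsymptoticallyFixed e f w := by
  intro τ hτ
  obtain ⟨ρ, hρ, h⟩ := hX.exists_displacement_bound (𝕜 := 𝕜) hR hτ
  obtain ⟨m₁, h1⟩ := hf ρ hρ
  obtain ⟨m₂, h2⟩ := hv ρ hρ
  refine ⟨max m₁ m₂, fun m hm => ?_⟩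
  have hj' : Tendsto j atTop atTop := tendsto_atTop_mono hj tendsto_id
  have h3 := h2 m (le_of_max_le_right hm)
  filter_upwards [h3, hj'.eventually h3] with i hi hji
  have hLip := h1 m (le_of_max_le_left hm) (w i)
  refine h (e (v i)) (e (v (j i))) _ _ (hw i) (he _ _) ?_ ?_
  · exact (norm_sub_le_norm_sub_add_norm_sub _ (e (f^[m] (v i))) _).trans
      (add_le_add (hLip _) hi)
  · exact (norm_sub_le_norm_sub_add_norm_sub _ (e (f^[m] (v (j i)))) _).trans
      (add_le_add (hLip _) hji)

/-- Iterated halving: there are sequences of dyadic averages of the `u n`, still asymptotically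
fixed, whose terms are eventually as close to the weak limit as desired. -/
theorem exists_asymptoticallyFixed_near_weak_limit {ι : Type*} {e : ι → X} {f : ι → ι}
    {u : ℕ → ι} {x : X}
    (hX : ApproxParallelogram X) {R : ℝ} (hR : 0 < R) (he : ∀ a b, ‖e a - e b‖ ≤ R)
    (hx : ∀ a, ‖e a - x‖ ≤ R)
    (hmid : ∀ a b, ∃ c, e c = (2⁻¹ : 𝕜) • (e a + e b))
    (hf : ∀ ρ : ℝ, 0 < ρ → ∃ m₀ : ℕ, ∀ m ≥ m₀, ∀ a b,
      ‖e (f^[m] a) - e (f^[m] b)‖ ≤ (1 + ρ) * ‖e a - e b‖)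
    (hu : AsymptoticallyFixed e f u) (hux : WeaklyTendsto 𝕜 (fun n => e (u n)) x)
    {τ : ℝ} (hτ : 0 < τ) :
    ∃ v : ℕ → ι, AsymptoticallyFixed e f v ∧ ∀ᶠ n in atTop, ‖e (v n) - x‖ ≤ τ := by
  obtain ⟨θ, hθ0, hθ1, hθ⟩ := hX.exists_contraction (𝕜 := 𝕜)
  have key : ∀ k : ℕ, ∃ v : ℕ → ι, AsymptoticallyFixed e f v ∧
      WeaklyTendsto 𝕜 (fun n => e (v n)) x ∧ ∀ᶠ n in atTop, ‖e (v n) - x‖ ≤ θ ^ k * R := by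
    intro k
    induction k with
    | zero => exact ⟨u, hu, hux, Eventually.of_forall fun n => by simpa using hx _⟩
    | succ k ih =>
      obtain ⟨v, hv1, hv2, hv3⟩ := ih
      obtain ⟨j, hj, hjR⟩ := hθ _ x _ (by positivity) hv2 hv3
      choose mid hm using hmid
      refine ⟨fun i => mid (v i) (v (j i)),
        hv1.midpoint hX hR he hf (fun i => hm _ _) hj, ?_, ?_⟩
      · intro φ
        have hj' : Tendsto j atTop atTop := tendsto_atTop_mono hj tendsto_id
        have := ((hv2 φ).add ((hv2 φ).comp hj')).const_mul (2⁻¹ : 𝕜)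
        have e1 : (2⁻¹ : 𝕜) * (φ x + φ x) = φ x := by
          rw [← two_mul, inv_mul_cancel_left₀ two_ne_zero]
        rw [e1] at this
        refine this.congr fun i => ?_
        simp only [hm, map_smul, map_add, smul_eq_mul, Function.comp]
      · filter_upwards [hjR] with i hi
        rw [hm, pow_succ', mul_assoc]
        exact hi
  obtain ⟨k, hk⟩ := exists_pow_lt_of_lt_one (show 0 < τ / R by positivity) hθ1
  obtain ⟨v, hv1, -, hv3⟩ := key k
  refine ⟨v, hv1, hv3.mono fun n hn => hn.trans ?_⟩
  rw [lt_div_iff₀ hR] at hk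
  exact hk.le

/-- The demiclosedness principle: the weak limit `e a` is fixed by `f`, up to the seminorm. -/
theorem norm_map_sub_self_eq_zero_of_weak_limit {ι : Type*} {e : ι → X} {f : ι → ι}
    {u : ℕ → ι} {a : ι}
    (hX : ApproxParallelogram X) {R : ℝ} (hR : 0 < R) (he : ∀ a b, ‖e a - e b‖ ≤ R)
    (hmid : ∀ a b, ∃ c, e c = (2⁻¹ : 𝕜) • (e a + e b)) {L : ℝ}
    (hL : ∀ a b, ‖e (f a) - e (f b)‖ ≤ L * ‖e a - e b‖)
    (hf : ∀ ρ : ℝ, 0 < ρ → ∃ m₀ : ℕ, ∀ m ≥ m₀, ∀ a b,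
      ‖e (f^[m] a) - e (f^[m] b)‖ ≤ (1 + ρ) * ‖e a - e b‖)
    (hu : AsymptoticallyFixed e f u) (hux : WeaklyTendsto 𝕜 (fun n => e (u n)) (e a)) :
    ‖e (f a) - e a‖ = 0 := by
  have h : Tendsto (fun m => ‖e (f^[m] a) - e a‖) atTop (𝓝 0) := by
    rw [Metric.tendsto_atTop]
    intro ε hε
    obtain ⟨v, hv1, hv2⟩ := exists_asymptoticallyFixed_near_weak_limit (𝕜 := 𝕜) hX hR he
      (fun b => he b a) hmid hf hu hux (show 0 < ε / 5 by positivity)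
    obtain ⟨m₁, h1⟩ := hf 1 one_pos
    obtain ⟨m₂, h2⟩ := hv1 (ε / 5) (by positivity)
    refine ⟨max m₁ m₂, fun m hm => ?_⟩
    obtain ⟨n, hn1, hn2⟩ := (hv2.and (h2 m (le_of_max_le_right hm))).exists
    have h3 := h1 m (le_of_max_le_left hm) a (v n)
    rw [norm_sub_rev (e a)] at h3
    rw [dist_zero_right, norm_norm]
    have h4 := norm_sub_le_norm_sub_add_norm_sub (e (f^[m] a)) (e (f^[m] (v n))) (e a)
    have h5 := norm_sub_le_norm_sub_add_norm_sub (e (f^[m] (v n))) (e (v n)) (e a)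
    linarith
  have h1 : Tendsto (fun m => L * ‖e (f^[m] a) - e a‖ + ‖e (f^[m + 1] a) - e a‖) atTop (𝓝 0) := by
    simpa using (h.const_mul L).add (h.comp (tendsto_add_atTop_nat 1))
  refine le_antisymm (ge_of_tendsto' h1 fun m => ?_) (norm_nonneg _)
  rw [Function.iterate_succ_apply']
  refine (norm_sub_le_norm_sub_add_norm_sub _ (e (f (f^[m] a))) _).trans ?_
  rw [norm_sub_rev (e (f a))]
  gcongr
  exact hL _ _

end Deterministic

/-! ### The approximate parallelogram law in random normed modules -/

/-- The approximate parallelogram law for the values `a = ‖x‖`, `b = ‖y‖`, `d = ‖x - y‖` and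
`s = ‖x + y‖` of the norms at a point, from a modulus of convexity `η` at `ε`. -/
theorem exists_real_approxParallelogram {η ε : ℝ} (hη : 0 < η) (hη1 : η ≤ 1) :
    ∃ C : ℝ, 0 < C ∧ ∀ a b d s : ℝ, 0 ≤ a → 0 ≤ b → 0 ≤ d → 0 ≤ s → s ≤ a + b → d ≤ a + b →
      (ε * max a b ≤ d → s ≤ 2 * (1 - η) * max a b) →
      d ^ 2 ≤ C * (2 * a ^ 2 + 2 * b ^ 2 - s ^ 2) + ε ^ 2 * (a ^ 2 + b ^ 2) := by
  refine ⟨16 / η ^ 2, by positivity, ?_⟩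
  -- by symmetry `a` may be taken to be the larger of the two norms
  have main : ∀ a b d s : ℝ, 0 ≤ b → b ≤ a → 0 ≤ d → 0 ≤ s → s ≤ a + b → d ≤ a + b →
      (ε * a ≤ d → s ≤ 2 * (1 - η) * a) →
      d ^ 2 ≤ 16 / η ^ 2 * (2 * a ^ 2 + 2 * b ^ 2 - s ^ 2) + ε ^ 2 * (a ^ 2 + b ^ 2) := by
    intro a b d s hb hba hd hs hsab hdab h
    have hs2 : s ^ 2 ≤ (a + b) ^ 2 := by gcongr
    have hd2 : d ^ 2 ≤ (a + b) ^ 2 := by gcongr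
    have hpos : 0 ≤ 2 * a ^ 2 + 2 * b ^ 2 - s ^ 2 := by nlinarith [sq_nonneg (a - b)]
    by_cases hε : ε * a ≤ d
    · have h1 : s ^ 2 ≤ (2 * (1 - η) * a) ^ 2 := by gcongr; exact h hε
      have ha : 0 ≤ a := hb.trans hba
      have h2 : η ^ 2 * a ^ 2 / 4 ≤ 2 * a ^ 2 + 2 * b ^ 2 - s ^ 2 := by
        by_cases hc : b ≤ (1 - η / 2) * a
        · have : (η / 2 * a) ^ 2 ≤ (a - b) ^ 2 := by gcongr; linarith
          nlinarith
        · have hb2 : ((1 - η / 2) * a) ^ 2 ≤ b ^ 2 := by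
            have : 0 ≤ (1 - η / 2) * a := mul_nonneg (by linarith) ha
            gcongr; exact (not_le.1 hc).le
          have h0 : 0 ≤ a ^ 2 * η * (1 - η) := by
            have : 0 ≤ 1 - η := by linarith
            positivity
          have h0' : 0 ≤ a ^ 2 * η := by positivity
          nlinarith
      have h3 : d ^ 2 ≤ 4 * a ^ 2 := by nlinarith
      have h4 : 4 * a ^ 2 = 16 / η ^ 2 * (η ^ 2 * a ^ 2 / 4) := by field_simp; ring
      have h5 : 16 / η ^ 2 * (η ^ 2 * a ^ 2 / 4) ≤ 16 / η ^ 2 * (2 * a ^ 2 + 2 * b ^ 2 - s ^ 2) := by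
        gcongr
      nlinarith [mul_nonneg (sq_nonneg ε) (add_nonneg (sq_nonneg a) (sq_nonneg b))]
    · have h1 : d ^ 2 ≤ (ε * a) ^ 2 := by gcongr; exact (not_le.1 hε).le
      have h2 : 0 ≤ 16 / η ^ 2 * (2 * a ^ 2 + 2 * b ^ 2 - s ^ 2) := by positivity
      nlinarith [mul_nonneg (sq_nonneg ε) (sq_nonneg b)]
  intro a b d s ha hb hd hs hsab hdab h
  rcases le_total b a with hba | hab
  · rw [max_eq_left hba] at h
    exact main a b d s hb hba hd hs hsab hdab h
  · rw [max_eq_right hab] at h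
    have := main b a d s ha hab hd hs (by linarith) (by linarith) h
    linarith

section Module

variable {Ω : Type*} [MeasurableSpace Ω] {P : Measure Ω} {𝕜 : Type*} [RCLike 𝕜]
  {E : Type*} [AddCommGroup E] [Module (Ω →ₘ[P] 𝕜) E] [RNModule P 𝕜 E]

variable (P 𝕜) in
theorem ae_rnorm_nonneg (x : E) : ∀ᵐ ω ∂P, 0 ≤ rnorm P 𝕜 x ω := by
  filter_upwards [AEEqFun.coeFn_le.2 (RNModule.rnorm_nonneg (P := P) (𝕜 := 𝕜) x),
    AEEqFun.coeFn_zero (μ := P) (β := ℝ)] with ω h1 h2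
  rwa [h2] at h1

variable (P 𝕜) in
theorem ae_rnorm_add_le (x y : E) :
    ∀ᵐ ω ∂P, rnorm P 𝕜 (x + y) ω ≤ rnorm P 𝕜 x ω + rnorm P 𝕜 y ω := by
  filter_upwards [AEEqFun.coeFn_le.2 (RNModule.rnorm_add_le (P := P) (𝕜 := 𝕜) x y),
    AEEqFun.coeFn_add (rnorm P 𝕜 x) (rnorm P 𝕜 y)] with ω h1 h2
  exact h1.trans h2.le

variable (P 𝕜) in
theorem ae_rnorm_sub_le (x y : E) :
    ∀ᵐ ω ∂P, rnorm P 𝕜 (x - y) ω ≤ rnorm P 𝕜 x ω + rnorm P 𝕜 y ω := by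
  have := ae_rnorm_add_le P 𝕜 x (-y)
  rwa [rnorm_neg, ← sub_eq_add_neg] at this

theorem ae_rnorm_smul (ξ : Ω →ₘ[P] 𝕜) (x : E) :
    ∀ᵐ ω ∂P, rnorm P 𝕜 (ξ • x) ω = ‖ξ ω‖ * rnorm P 𝕜 x ω := by
  have h : rnorm P 𝕜 (ξ • x) = L0abs ξ * rnorm P 𝕜 x := RNModule.rnorm_smul ξ x
  rw [h]
  filter_upwards [AEEqFun.coeFn_mul (L0abs ξ) (rnorm P 𝕜 x), coeFn_L0abs ξ] with ω h1 h2
  rw [h1, Pi.mul_apply, h2]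

theorem coeFn_L0ofReal (ξ : L0 P ℝ) : ∀ᵐ ω ∂P, L0ofReal 𝕜 ξ ω = (ξ ω : 𝕜) :=
  AEEqFun.coeFn_comp _ _ _

/-- Random uniform convexity with a constant `ε` has a deterministic modulus; normalising by the
larger of the two norms frees it from the unit ball and from the support conditions. -/
theorem IsRandomUniformlyConvex.exists_modulus (h : IsRandomUniformlyConvex P 𝕜 E)
    {ε : ℝ} (hε : 0 < ε) (hε2 : ε ≤ 2) :
    ∃ η : ℝ, 0 < η ∧ η ≤ 1 ∧ ∀ x y : E, ∀ᵐ ω ∂P,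
      ε * max (rnorm P 𝕜 x ω) (rnorm P 𝕜 y ω) ≤ rnorm P 𝕜 (x - y) ω →
      rnorm P 𝕜 (x + y) ω ≤ 2 * (1 - η) * max (rnorm P 𝕜 x ω) (rnorm P 𝕜 y ω) := by
  obtain ⟨δ, ⟨η, hη, hδ⟩, H⟩ := h (AEEqFun.const Ω ε) ⟨ε, hε, by
    filter_upwards [AEEqFun.coeFn_const Ω (μ := P) ε] with ω hω
    rw [hω]; exact ⟨le_rfl, hε2⟩⟩
  refine ⟨min η (1 / 2), by positivity, (min_le_right _ _).trans (by norm_num), fun x y => ?_⟩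
  -- `ξ` is the inverse of the larger norm, with value `0` where both norms vanish
  let M : Ω →ₘ[P] ℝ := rnorm P 𝕜 x ⊔ rnorm P 𝕜 y
  let ξr : Ω →ₘ[P] ℝ := AEEqFun.compMeasurable (fun r : ℝ => r⁻¹) measurable_inv M
  have hξr : ∀ᵐ ω ∂P, L0ofReal 𝕜 ξr ω = ((max (rnorm P 𝕜 x ω) (rnorm P 𝕜 y ω))⁻¹ : ℝ) := by
    filter_upwards [coeFn_L0ofReal (𝕜 := 𝕜) ξr, AEEqFun.coeFn_compMeasurable (μ := P)
      (fun r : ℝ => r⁻¹) measurable_inv M, AEEqFun.coeFn_sup (rnorm P 𝕜 x) (rnorm P 𝕜 y)]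
      with ω h1 h2 h3
    rw [h1, h2]
    simp only [Function.comp, M, h3]
  set ξ : Ω →ₘ[P] 𝕜 := L0ofReal 𝕜 ξr
  have hnorm : ∀ z : E, ∀ᵐ ω ∂P,
      rnorm P 𝕜 (ξ • z) ω = (max (rnorm P 𝕜 x ω) (rnorm P 𝕜 y ω))⁻¹ * rnorm P 𝕜 z ω := by
    intro z
    filter_upwards [ae_rnorm_smul ξ z, hξr, ae_rnorm_nonneg P 𝕜 x] with ω h1 h2 h3
    rw [h1, h2, RCLike.norm_ofReal, abs_of_nonneg (inv_nonneg.2 (h3.trans (le_max_left _ _)))]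
  have hle : ∀ z : E, (∀ᵐ ω ∂P, rnorm P 𝕜 z ω ≤ max (rnorm P 𝕜 x ω) (rnorm P 𝕜 y ω)) →
      rnorm P 𝕜 (ξ • z) ≤ 1 := by
    intro z hz
    rw [← AEEqFun.coeFn_le]
    filter_upwards [hnorm z, hz, AEEqFun.coeFn_one (μ := P) (β := ℝ), ae_rnorm_nonneg P 𝕜 x]
      with ω h1 h2 h3 h4
    rw [h1, h3]
    exact inv_mul_le_one_of_le₀ h2 (h4.trans (le_max_left _ _))
  let D : Set Ω := {ω | ε ≤ rnorm P 𝕜 (ξ • x - ξ • y) ω ∧ rnorm P 𝕜 (ξ • x) ω ≠ 0 ∧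
    rnorm P 𝕜 (ξ • y) ω ≠ 0}
  have hD : MeasurableSet D :=
    (measurableSet_le measurable_const (rnorm P 𝕜 (ξ • x - ξ • y)).measurable).inter
      (((rnorm P 𝕜 (ξ • x)).measurable (measurableSet_singleton 0).compl).inter
      ((rnorm P 𝕜 (ξ • y)).measurable (measurableSet_singleton 0).compl))
  have hmain : ∀ᵐ ω ∂P, ω ∈ D → rnorm P 𝕜 (ξ • x + ξ • y) ω ≤ 2 * (1 - δ ω) := by
    by_cases hPD : P D = 0
    · filter_upwards [measure_eq_zero_iff_ae_notMem.1 hPD] with ω h1 h2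
      exact absurd h2 h1
    · refine H _ _ (hle x (Eventually.of_forall fun _ => le_max_left _ _))
        (hle y (Eventually.of_forall fun _ => le_max_right _ _)) D hD (pos_iff_ne_zero.2 hPD)
        (Eventually.of_forall fun ω hω => ⟨hω.2.1, hω.2.2, (hε.trans_le hω.1).ne'⟩) ?_
      filter_upwards [AEEqFun.coeFn_const Ω (μ := P) ε] with ω h1 h2
      rw [h1]; exact h2.1
  rw [← smul_add] at hmain
  have hsub := hnorm (x - y)
  rw [smul_sub] at hsub
  filter_upwards [hmain, hδ, hnorm x, hnorm y, hnorm (x + y), hsub, ae_rnorm_nonneg P 𝕜 x,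
    ae_rnorm_nonneg P 𝕜 y, ae_rnorm_add_le P 𝕜 x y] with ω h1 h2 hx hy hxy hxmy px py padd hd
  set a := rnorm P 𝕜 x ω
  set b := rnorm P 𝕜 y ω
  have hη2 : min η (1 / 2) ≤ 1 / 2 := min_le_right _ _
  have hmax : 0 ≤ max a b := px.trans (le_max_left _ _)
  -- where `x` or `y` vanishes, `‖x + y‖` is at most the larger norm, and `η ≤ 1 / 2` suffices
  rcases px.eq_or_lt with ha | ha
  · have : 0 ≤ (1 / 2 - min η (1 / 2)) * b := mul_nonneg (by linarith) py
    rw [← ha, max_eq_right py]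
    linarith
  rcases py.eq_or_lt with hb | hb
  · have : 0 ≤ (1 / 2 - min η (1 / 2)) * a := mul_nonneg (by linarith) px
    rw [← hb, max_eq_left px]
    linarith
  have hM : 0 < max a b := ha.trans_le (le_max_left _ _)
  have hmem : ω ∈ D := by
    refine ⟨?_, ?_, ?_⟩
    · rw [hxmy, inv_mul_eq_div, le_div_iff₀ hM]; exact hd
    · rw [hx]; positivity
    · rw [hy]; positivity
  have h3 := h1 hmem
  rw [hxy, inv_mul_eq_div, div_le_iff₀ hM] at h3
  refine h3.trans ?_
  gcongr
  exact (min_le_left _ _).trans h2.1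

theorem IsRandomUniformlyConvex.ae_approxParallelogram (h : IsRandomUniformlyConvex P 𝕜 E)
    {ε : ℝ} (hε : 0 < ε) : ∃ C : ℝ, 0 < C ∧ ∀ x y : E, ∀ᵐ ω ∂P,
      rnorm P 𝕜 (x - y) ω ^ 2 ≤ C * (2 * rnorm P 𝕜 x ω ^ 2 + 2 * rnorm P 𝕜 y ω ^ 2 -
        rnorm P 𝕜 (x + y) ω ^ 2) + ε * (rnorm P 𝕜 x ω ^ 2 + rnorm P 𝕜 y ω ^ 2) := by
  have hε' : 0 < min (√ε) 2 := lt_min (Real.sqrt_pos.2 hε) two_pos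
  obtain ⟨η, hη, hη1, H⟩ := h.exists_modulus hε' (min_le_right _ _)
  obtain ⟨C, hC, hreal⟩ := exists_real_approxParallelogram (ε := min (√ε) 2) hη hη1
  refine ⟨C, hC, fun x y => ?_⟩
  filter_upwards [H x y, ae_rnorm_nonneg P 𝕜 x, ae_rnorm_nonneg P 𝕜 y,
    ae_rnorm_nonneg P 𝕜 (x - y), ae_rnorm_nonneg P 𝕜 (x + y), ae_rnorm_add_le P 𝕜 x y,
    ae_rnorm_sub_le P 𝕜 x y] with ω h1 h2 h3 h4 h5 h6 h7
  refine (hreal _ _ _ _ h2 h3 h4 h5 h6 h7 h1).trans ?_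
  have : min (√ε) 2 ^ 2 ≤ ε := by
    calc min (√ε) 2 ^ 2 ≤ √ε ^ 2 := by gcongr; exact min_le_left _ _
      _ = ε := Real.sq_sqrt hε.le
  gcongr

end Module

/-! ### The seminormed space of elements square integrable on a set -/

section L2

variable {Ω : Type*} [MeasurableSpace Ω] (P : Measure Ω) (𝕜 : Type*) [RCLike 𝕜]

/-- The constants in `L⁰(F, 𝕜)`. -/
noncomputable def constHom : 𝕜 →+* (Ω →ₘ[P] 𝕜) where
  toFun := AEEqFun.const Ω
  map_one' := rfl
  map_zero' := rfl
  map_add' _ _ := rfl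
  map_mul' _ _ := rfl

theorem coeFn_constHom (c : 𝕜) : ∀ᵐ ω ∂P, constHom P 𝕜 c ω = c :=
  AEEqFun.coeFn_const Ω c

variable (E : Type*) [AddCommGroup E] [Module (Ω →ₘ[P] 𝕜) E] [RNModule P 𝕜 E]

/-- The elements of `E` whose norm is square integrable over `A`. -/
def sqIntegrableOn (A : Set Ω) : AddSubgroup E where
  carrier := {y | MemLp (rnorm P 𝕜 y) 2 (P.restrict A)}
  zero_mem' := by
    change MemLp (rnorm P 𝕜 (0 : E)) 2 (P.restrict A)
    rw [rnorm_zero]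
    refine (MemLp.zero (ε := ℝ)).ae_eq (ae_restrict_of_ae ?_)
    exact (AEEqFun.coeFn_zero (μ := P) (β := ℝ)).symm
  add_mem' {x y} hx hy := by
    refine (MemLp.add hx hy).mono (rnorm P 𝕜 (x + y)).stronglyMeasurable.aestronglyMeasurable
      (ae_restrict_of_ae ?_)
    filter_upwards [ae_rnorm_add_le P 𝕜 x y, ae_rnorm_nonneg P 𝕜 (x + y)] with ω h1 h2
    rw [Real.norm_of_nonneg h2]
    exact h1.trans (le_abs_self _)
  neg_mem' {x} hx := by
    change MemLp (rnorm P 𝕜 (-x)) 2 (P.restrict A)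
    rwa [rnorm_neg]

/-- The space `L²` of elements of `E` over `A`. Elements that agree on `A` are not identified, so
it carries only a seminorm. -/
abbrev L2Space (A : Set Ω) : Type _ := sqIntegrableOn P 𝕜 E A

variable {E} {A : Set Ω}

theorem eLpNorm_rnorm_add_le (x y : E) :
    eLpNorm (rnorm P 𝕜 (x + y)) 2 (P.restrict A) ≤
      eLpNorm (rnorm P 𝕜 x) 2 (P.restrict A) + eLpNorm (rnorm P 𝕜 y) 2 (P.restrict A) := by
  have h : ∀ᵐ ω ∂P.restrict A,
      ‖rnorm P 𝕜 (x + y) ω‖ ≤ ‖(⇑(rnorm P 𝕜 x) + ⇑(rnorm P 𝕜 y)) ω‖ := by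
    refine ae_restrict_of_ae ?_
    filter_upwards [ae_rnorm_add_le P 𝕜 x y, ae_rnorm_nonneg P 𝕜 (x + y)] with ω h1 h2
    rw [Real.norm_of_nonneg h2]
    exact h1.trans (le_abs_self _)
  exact (eLpNorm_mono_ae h).trans (eLpNorm_add_le
    (rnorm P 𝕜 x).stronglyMeasurable.aestronglyMeasurable
    (rnorm P 𝕜 y).stronglyMeasurable.aestronglyMeasurable one_le_two)

theorem eLpNorm_rnorm_zero : eLpNorm (rnorm P 𝕜 (0 : E)) 2 (P.restrict A) = 0 := by
  rw [rnorm_zero, eLpNorm_congr_ae (ae_restrict_of_ae (AEEqFun.coeFn_zero (μ := P) (β := ℝ)))]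
  exact eLpNorm_zero

/-- The seminorm `(∫_A ‖y‖² dP)^(1/2)`. -/
noncomputable def L2Space.seminorm : AddGroupSeminorm (L2Space P 𝕜 E A) where
  toFun y := (eLpNorm (rnorm P 𝕜 y.1) 2 (P.restrict A)).toReal
  map_zero' := by rw [ZeroMemClass.coe_zero, eLpNorm_rnorm_zero, ENNReal.toReal_zero]
  add_le' x y := by
    rw [← ENNReal.toReal_add x.2.eLpNorm_ne_top y.2.eLpNorm_ne_top, AddSubgroup.coe_add]
    exact ENNReal.toReal_mono (ENNReal.add_ne_top.2 ⟨x.2.eLpNorm_ne_top,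
      y.2.eLpNorm_ne_top⟩) (eLpNorm_rnorm_add_le P 𝕜 x.1 y.1)
  neg' x := by rw [AddSubgroup.coe_neg, rnorm_neg]

noncomputable instance : SeminormedAddCommGroup (L2Space P 𝕜 E A) :=
  (L2Space.seminorm P 𝕜).toSeminormedAddCommGroup

namespace L2Space

variable {P 𝕜}

theorem norm_def (y : L2Space P 𝕜 E A) :
    ‖y‖ = (eLpNorm (rnorm P 𝕜 y.1) 2 (P.restrict A)).toReal := rfl

theorem integrable_sq (y : L2Space P 𝕜 E A) :
    Integrable (fun ω => rnorm P 𝕜 y.1 ω ^ 2) (P.restrict A) :=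
  (memLp_two_iff_integrable_sq y.2.1).1 y.2

theorem norm_sq (y : L2Space P 𝕜 E A) :
    ‖y‖ ^ 2 = ∫ ω in A, rnorm P 𝕜 y.1 ω ^ 2 ∂P := by
  rw [norm_def, y.2.eLpNorm_eq_integral_rpow_norm two_ne_zero ENNReal.ofNat_ne_top,
    ENNReal.toReal_ofReal (by positivity), ← Real.rpow_natCast, ← Real.rpow_mul (by positivity)]
  simp

end L2Space

theorem ae_rnorm_constHom_smul (c : 𝕜) (x : E) :
    ∀ᵐ ω ∂P, rnorm P 𝕜 (constHom P 𝕜 c • x) ω = ‖c‖ * rnorm P 𝕜 x ω := by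
  filter_upwards [ae_rnorm_smul (constHom P 𝕜 c) x, coeFn_constHom P 𝕜 c] with ω h1 h2
  rw [h1, h2]

noncomputable instance : Module 𝕜 (L2Space P 𝕜 E A) where
  smul c y := ⟨constHom P 𝕜 c • y.1, by
    refine (MemLp.const_mul y.2 ‖c‖).ae_eq (ae_restrict_of_ae ?_)
    filter_upwards [ae_rnorm_constHom_smul P 𝕜 c y.1] with ω h1
    exact h1.symm⟩
  one_smul y := Subtype.ext (by
    change constHom P 𝕜 1 • y.1 = y.1; rw [map_one, one_smul])
  mul_smul a b y := Subtype.ext (by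
    change constHom P 𝕜 (a * b) • y.1 = constHom P 𝕜 a • constHom P 𝕜 b • y.1
    rw [map_mul, mul_smul])
  smul_zero a := Subtype.ext (smul_zero (constHom P 𝕜 a))
  smul_add a x y := Subtype.ext (smul_add (constHom P 𝕜 a) x.1 y.1)
  add_smul a b x := Subtype.ext (by
    change constHom P 𝕜 (a + b) • x.1 = constHom P 𝕜 a • x.1 + constHom P 𝕜 b • x.1
    rw [map_add, add_smul])
  zero_smul x := Subtype.ext (by
    change constHom P 𝕜 0 • x.1 = 0; rw [map_zero, zero_smul])

namespace L2Space

variable {P 𝕜}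

@[simp] theorem coe_smul (c : 𝕜) (y : L2Space P 𝕜 E A) : (c • y).1 = constHom P 𝕜 c • y.1 := rfl

noncomputable instance : NormedSpace 𝕜 (L2Space P 𝕜 E A) where
  norm_smul_le c y := by
    refine le_of_sq_le_sq ?_ (by positivity)
    rw [mul_pow, norm_sq, norm_sq, ← integral_const_mul]
    refine le_of_eq (integral_congr_ae (ae_restrict_of_ae ?_))
    filter_upwards [ae_rnorm_constHom_smul P 𝕜 c y.1] with ω h1
    rw [coe_smul, h1, mul_pow]

variable (A) in
theorem approxParallelogram (h : IsRandomUniformlyConvex P 𝕜 E) :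
    ApproxParallelogram (L2Space P 𝕜 E A) := by
  intro ε hε
  obtain ⟨C, hC, H⟩ := h.ae_approxParallelogram hε
  refine ⟨C, hC, fun x y => ?_⟩
  have ix := x.integrable_sq
  have iy := y.integrable_sq
  have is := (x + y).integrable_sq
  simp only [norm_sq]
  have i1 : Integrable (fun ω => 2 * rnorm P 𝕜 x.1 ω ^ 2 + 2 * rnorm P 𝕜 y.1 ω ^ 2)
      (P.restrict A) := (ix.const_mul 2).add (iy.const_mul 2)
  have i2 : Integrable (fun ω => 2 * rnorm P 𝕜 x.1 ω ^ 2 + 2 * rnorm P 𝕜 y.1 ω ^ 2 -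
      rnorm P 𝕜 (x + y).1 ω ^ 2) (P.restrict A) := i1.sub is
  have i3 : Integrable (fun ω => rnorm P 𝕜 x.1 ω ^ 2 + rnorm P 𝕜 y.1 ω ^ 2)
      (P.restrict A) := ix.add iy
  rw [← integral_const_mul, ← integral_const_mul, ← integral_add (ix.const_mul 2) (iy.const_mul 2),
    ← integral_sub i1 is, ← integral_const_mul,
    ← integral_add ix iy, ← integral_const_mul, ← integral_add (i2.const_mul C) (i3.const_mul ε)]
  exact integral_mono_ae (x - y).integrable_sq ((i2.const_mul C).add (i3.const_mul ε))
    (ae_restrict_of_ae (H x.1 y.1))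

end L2Space

variable {P}

theorem sqIntegrableOn_of_bounded [IsFiniteMeasure P] {y : E} {K : ℝ}
    (hK : ∀ᵐ ω ∂P.restrict A, rnorm P 𝕜 y ω ≤ K) : y ∈ sqIntegrableOn P 𝕜 E A := by
  refine MemLp.of_bound (rnorm P 𝕜 y).stronglyMeasurable.aestronglyMeasurable K ?_
  filter_upwards [hK, ae_restrict_of_ae (ae_rnorm_nonneg P 𝕜 y)] with ω h1 h2
  rwa [Real.norm_of_nonneg h2]

variable {𝕜}

namespace L2Space

/-- The seminorm of an element bounded by `K` on `A` and by `ε` on `A \ B`. -/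
theorem norm_sq_le [IsProbabilityMeasure P] (y : L2Space P 𝕜 E A) {K ε : ℝ} {B : Set Ω}
    (hB : MeasurableSet B)
    (hK : ∀ᵐ ω ∂P.restrict A, rnorm P 𝕜 y.1 ω ≤ K)
    (hε : ∀ᵐ ω ∂P.restrict A, ω ∉ B → rnorm P 𝕜 y.1 ω ≤ ε) :
    ‖y‖ ^ 2 ≤ ε ^ 2 + K ^ 2 * P.real B := by
  rw [norm_sq]
  have hint : Integrable (fun ω => ε ^ 2 + B.indicator (fun _ => K ^ 2) ω) P :=
    (integrable_const _).add ((integrable_const _).indicator hB)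
  calc ∫ ω in A, rnorm P 𝕜 y.1 ω ^ 2 ∂P
      ≤ ∫ ω in A, ε ^ 2 + B.indicator (fun _ => K ^ 2) ω ∂P := by
        refine integral_mono_ae y.integrable_sq hint.restrict ?_
        filter_upwards [hK, hε, ae_restrict_of_ae (ae_rnorm_nonneg P 𝕜 y.1)] with ω h1 h2 h3
        by_cases hω : ω ∈ B
        · rw [Set.indicator_of_mem hω]
          have : rnorm P 𝕜 y.1 ω ^ 2 ≤ K ^ 2 := by gcongr
          nlinarith [sq_nonneg ε]
        · rw [Set.indicator_of_notMem hω, add_zero]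
          have := h2 hω
          change rnorm P 𝕜 y.1 ω ^ 2 ≤ ε ^ 2
          gcongr
    _ ≤ ∫ ω, ε ^ 2 + B.indicator (fun _ => K ^ 2) ω ∂P := by
        refine setIntegral_le_integral hint (Eventually.of_forall fun ω => ?_)
        exact add_nonneg (sq_nonneg _) (Set.indicator_nonneg (fun _ _ => sq_nonneg _) _)
    _ = ε ^ 2 + K ^ 2 * P.real B := by
        rw [integral_add (integrable_const _) ((integrable_const _).indicator hB),
          integral_indicator hB]
        simp [mul_comm]

theorem norm_le_of_bounded [IsProbabilityMeasure P] (y : L2Space P 𝕜 E A) {K : ℝ} (hK0 : 0 ≤ K)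
    (hK : ∀ᵐ ω ∂P.restrict A, rnorm P 𝕜 y.1 ω ≤ K) : ‖y‖ ≤ K := by
  have := y.norm_sq_le (ε := K) (B := ∅) MeasurableSet.empty hK (hK.mono fun _ h _ => h)
  rw [measureReal_empty, mul_zero, add_zero] at this
  exact le_of_sq_le_sq this hK0

theorem norm_le_mul [IsProbabilityMeasure P] (x y : L2Space P 𝕜 E A) {K : ℝ} (hK0 : 0 ≤ K)
    (hK : ∀ᵐ ω ∂P.restrict A, rnorm P 𝕜 x.1 ω ≤ K * rnorm P 𝕜 y.1 ω) : ‖x‖ ≤ K * ‖y‖ := by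
  refine le_of_sq_le_sq ?_ (by positivity)
  rw [mul_pow, norm_sq, norm_sq, ← integral_const_mul]
  refine integral_mono_ae x.integrable_sq (y.integrable_sq.const_mul _) ?_
  filter_upwards [hK, ae_restrict_of_ae (ae_rnorm_nonneg P 𝕜 x.1)] with ω h1 h2
  change _ ≤ K ^ 2 * rnorm P 𝕜 y.1 ω ^ 2
  rw [← mul_pow]
  gcongr

end L2Space

end L2

/-! ### Densities of continuous functionals -/

section Duality

open scoped ComplexConjugate InnerProductSpace

variable {Ω : Type*} [MeasurableSpace Ω] {P : Measure Ω}
  {𝕜 : Type*} [RCLike 𝕜]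
  {E : Type*} [AddCommGroup E] [Module (Ω →ₘ[P] 𝕜) E] [RNModule P 𝕜 E] {A : Set Ω}

/-- `g` is a density of the functional `h ↦ φ (h • y)` on the coefficients `h` dominated by
`w`. The weight `w` keeps `h • y` in `L²` and `h * g` integrable. -/
def IsDensity (φ : L2Space P 𝕜 E A →L[𝕜] 𝕜) (y : E) (g : Ω →ₘ[P] 𝕜) (w : Ω → ℝ) : Prop :=
  ∀ h : Ω →ₘ[P] 𝕜, (∀ᵐ ω ∂P, ‖h ω‖ ≤ w ω) → Integrable (fun ω => h ω * g ω) P ∧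
    ∃ hy : h • y ∈ sqIntegrableOn P 𝕜 E A, φ ⟨h • y, hy⟩ = ∫ ω, h ω * g ω ∂P

theorem IsDensity.mono {φ : L2Space P 𝕜 E A →L[𝕜] 𝕜} {y : E} {g : Ω →ₘ[P] 𝕜} {w w' : Ω → ℝ}
    (hg : IsDensity φ y g w) (hw : ∀ ω, w' ω ≤ w ω) : IsDensity φ y g w' :=
  fun h hh => hg h (hh.mono fun ω hω => hω.trans (hw ω))

theorem IsDensity.add {φ : L2Space P 𝕜 E A →L[𝕜] 𝕜} {y₁ y₂ : E} {g₁ g₂ : Ω →ₘ[P] 𝕜} {w : Ω → ℝ}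
    (h₁ : IsDensity φ y₁ g₁ w) (h₂ : IsDensity φ y₂ g₂ w) :
    IsDensity φ (y₁ + y₂) (g₁ + g₂) w := by
  intro h hh
  obtain ⟨i₁, m₁, e₁⟩ := h₁ h hh
  obtain ⟨i₂, m₂, e₂⟩ := h₂ h hh
  have hae : (fun ω => h ω * g₁ ω + h ω * g₂ ω) =ᵐ[P] fun ω => h ω * (g₁ + g₂) ω := by
    filter_upwards [AEEqFun.coeFn_add g₁ g₂] with ω h1
    rw [h1, Pi.add_apply, mul_add]
  refine ⟨(i₁.add i₂).congr hae, ?_, ?_⟩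
  · rw [smul_add]; exact add_mem m₁ m₂
  · rw [← integral_congr_ae hae, integral_add i₁ i₂, ← e₁, ← e₂, ← map_add]
    congr 1
    exact Subtype.ext (smul_add _ _ _)

theorem IsDensity.smul {φ : L2Space P 𝕜 E A →L[𝕜] 𝕜} {y : E} {g : Ω →ₘ[P] 𝕜} {w : Ω → ℝ}
    (hg : IsDensity φ y g w) (ξ : Ω →ₘ[P] 𝕜) :
    IsDensity φ (ξ • y) (ξ * g) (fun ω => w ω / (1 + ‖ξ ω‖)) := by
  intro h hh
  obtain ⟨i, m, e⟩ := hg (h * ξ) (by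
    filter_upwards [hh, AEEqFun.coeFn_mul h ξ] with ω h1 h2
    rw [h2, Pi.mul_apply, norm_mul]
    rw [le_div_iff₀ (by positivity)] at h1
    nlinarith [norm_nonneg (h ω)])
  have hae : (fun ω => (h * ξ) ω * g ω) =ᵐ[P] fun ω => h ω * (ξ * g) ω := by
    filter_upwards [AEEqFun.coeFn_mul h ξ, AEEqFun.coeFn_mul ξ g] with ω h1 h2
    rw [h1, h2, Pi.mul_apply, Pi.mul_apply, mul_assoc]
  refine ⟨i.congr hae, ?_, ?_⟩
  · rw [smul_smul]; exact m
  · rw [← integral_congr_ae hae, ← e]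
    congr 1
    exact Subtype.ext (smul_smul _ _ _)

/-- The coefficient `v · conj d / (1 + |d|)`, whose product with `d` is nonnegative. -/
noncomputable def testCoeff (v : Ω → ℝ) (d : Ω →ₘ[P] 𝕜) : Ω → 𝕜 :=
  fun ω => ((v ω / (1 + ‖d ω‖) : ℝ) : 𝕜) * conj (d ω)

theorem aestronglyMeasurable_testCoeff {v : Ω → ℝ} (hv : Measurable v) (d : Ω →ₘ[P] 𝕜) :
    AEStronglyMeasurable (testCoeff v d) P := by
  have h1 : Measurable d := d.measurable
  have : Measurable (testCoeff v d) := by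
    unfold testCoeff
    exact (RCLike.measurable_ofReal.comp (hv.div (measurable_const.add h1.norm))).mul
      (RCLike.continuous_conj.measurable.comp h1)
  exact this.aestronglyMeasurable

theorem norm_testCoeff_le {v : Ω → ℝ} (d : Ω →ₘ[P] 𝕜) {ω : Ω} (hv : 0 ≤ v ω) :
    ‖testCoeff v d ω‖ ≤ v ω := by
  rw [testCoeff, norm_mul, RCLike.norm_ofReal, RCLike.norm_conj, abs_of_nonneg (by positivity),
    div_mul_eq_mul_div, div_le_iff₀ (by positivity)]
  nlinarith [norm_nonneg (d ω)]

theorem testCoeff_mul_self (v : Ω → ℝ) (d : Ω →ₘ[P] 𝕜) (ω : Ω) :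
    testCoeff v d ω * d ω = ((v ω * (‖d ω‖ ^ 2 / (1 + ‖d ω‖)) : ℝ) : 𝕜) := by
  rw [testCoeff, mul_assoc, RCLike.conj_mul]
  push_cast
  ring

theorem IsDensity.unique {φ : L2Space P 𝕜 E A →L[𝕜] 𝕜} {y : E} {g g' : Ω →ₘ[P] 𝕜} {w : Ω → ℝ}
    (hw : Measurable w) (hw0 : ∀ᵐ ω ∂P, 0 < w ω)
    (hg : IsDensity φ y g w) (hg' : IsDensity φ y g' w) : g = g' := by
  set d := g - g' with hd
  have hm := aestronglyMeasurable_testCoeff hw d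
  -- testing both densities against `h` gives `∫ w |d|² / (1 + |d|) = 0`
  set h : Ω →ₘ[P] 𝕜 := AEEqFun.mk _ hm
  have hh : ∀ᵐ ω ∂P, h ω = testCoeff w d ω := AEEqFun.coeFn_mk _ hm
  have hhw : ∀ᵐ ω ∂P, ‖h ω‖ ≤ w ω := by
    filter_upwards [hh, hw0] with ω h1 h2
    rw [h1]; exact norm_testCoeff_le d h2.le
  obtain ⟨i, m, e⟩ := hg h hhw
  obtain ⟨i', m', e'⟩ := hg' h hhw
  have hae : (fun ω => h ω * g ω - h ω * g' ω) =ᵐ[P]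
      fun ω => ((w ω * (‖d ω‖ ^ 2 / (1 + ‖d ω‖)) : ℝ) : 𝕜) := by
    filter_upwards [hh, AEEqFun.coeFn_sub g g'] with ω h1 h2
    rw [← testCoeff_mul_self, h1, ← mul_sub, hd, h2, Pi.sub_apply]
  have h0 : ∫ ω, ((w ω * (‖d ω‖ ^ 2 / (1 + ‖d ω‖)) : ℝ) : 𝕜) ∂P = 0 := by
    rw [← integral_congr_ae hae, integral_sub i i', ← e, ← e', sub_self]
  have hi : Integrable (fun ω => w ω * (‖d ω‖ ^ 2 / (1 + ‖d ω‖))) P := by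
    have := ((i.sub i').congr hae).re
    simpa only [RCLike.ofReal_re] using this
  rw [integral_ofReal, RCLike.ofReal_eq_zero, integral_eq_zero_iff_of_nonneg_ae _ hi] at h0
  · refine sub_eq_zero.1 (AEEqFun.ext ?_)
    filter_upwards [h0, hw0, AEEqFun.coeFn_zero (μ := P) (β := 𝕜)] with ω h1 h2 h3
    rw [h3, Pi.zero_apply]
    simp only [Pi.zero_apply, mul_eq_zero, h2.ne', div_eq_zero_iff, false_or] at h1
    rcases h1 with h1 | h1
    · exact norm_eq_zero.1 (pow_eq_zero_iff two_ne_zero |>.1 h1)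
    · exact absurd h1 (by positivity)
  · filter_upwards [hw0] with ω h1
    exact mul_nonneg h1.le (by positivity)

/-- The weight `1 / (1 + ‖y‖)`. -/
noncomputable def unitWeight (P : Measure Ω) (𝕜 : Type*) [RCLike 𝕜]
    {E : Type*} [AddCommGroup E] [Module (Ω →ₘ[P] 𝕜) E] [RNModule P 𝕜 E] (y : E) : Ω → ℝ :=
  fun ω => (1 + rnorm P 𝕜 y ω)⁻¹

theorem measurable_unitWeight (y : E) : Measurable (unitWeight P 𝕜 y) :=
  (measurable_const.add (rnorm P 𝕜 y).measurable).inv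

theorem unitWeight_pos (y : E) : ∀ᵐ ω ∂P, 0 < unitWeight P 𝕜 y ω := by
  filter_upwards [ae_rnorm_nonneg P 𝕜 y] with ω h
  unfold unitWeight
  positivity

/-- Multiplying an element with `‖z‖ ≤ 1` by square integrable coefficients. -/
noncomputable def lpSmul (A : Set Ω) {z : E} (hz : ∀ᵐ ω ∂P, rnorm P 𝕜 z ω ≤ 1) :
    Lp 𝕜 2 P →L[𝕜] L2Space P 𝕜 E A :=
  have hle : ∀ h : Lp 𝕜 2 P, ∀ᵐ ω ∂P.restrict A,
      ‖rnorm P 𝕜 ((h : Ω →ₘ[P] 𝕜) • z) ω‖ ≤ ‖h ω‖ := fun h => by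
    refine ae_restrict_of_ae ?_
    filter_upwards [ae_rnorm_smul (h : Ω →ₘ[P] 𝕜) z, hz, ae_rnorm_nonneg P 𝕜 z] with ω h1 h2 h3
    rw [h1, Real.norm_of_nonneg (by positivity)]
    exact mul_le_of_le_one_right (norm_nonneg _) h2
  LinearMap.mkContinuous
    { toFun := fun h => ⟨(h : Ω →ₘ[P] 𝕜) • z, MemLp.mono ((Lp.memLp h).restrict A)
        (rnorm P 𝕜 _).stronglyMeasurable.aestronglyMeasurable (hle h)⟩
      map_add' := fun h h' => Subtype.ext (add_smul (h : Ω →ₘ[P] 𝕜) (h' : Ω →ₘ[P] 𝕜) z)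
      map_smul' := fun c h => Subtype.ext (by
        change ((c • h : Lp 𝕜 2 P) : Ω →ₘ[P] 𝕜) • z = constHom P 𝕜 c • (h : Ω →ₘ[P] 𝕜) • z
        rw [smul_smul]
        congr 1
        refine AEEqFun.ext ?_
        filter_upwards [Lp.coeFn_smul c h, AEEqFun.coeFn_mul (constHom P 𝕜 c) (h : Ω →ₘ[P] 𝕜),
          coeFn_constHom P 𝕜 c] with ω h1 h2 h3
        rw [h1, h2, Pi.mul_apply, h3, Pi.smul_apply, smul_eq_mul]) } 1 (fun h => by
      rw [one_mul, Lp.norm_def]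
      exact ENNReal.toReal_mono (Lp.memLp h).eLpNorm_ne_top
        ((eLpNorm_mono_ae (hle h)).trans (eLpNorm_mono_measure _ Measure.restrict_le_self)))

/-- After `y` is scaled to norm at most `1`, the density is the Riesz representative of
`h ↦ φ (h • y)` in `L²(P, 𝕜)`. -/
theorem exists_isDensity [IsProbabilityMeasure P] (φ : L2Space P 𝕜 E A →L[𝕜] 𝕜) (y : E) :
    ∃ g : Ω →ₘ[P] 𝕜, IsDensity φ y g (unitWeight P 𝕜 y) := by
  have hbm : AEStronglyMeasurable (fun ω => ((unitWeight P 𝕜 y ω : ℝ) : 𝕜)) P :=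
    (RCLike.measurable_ofReal.comp (measurable_unitWeight y)).aestronglyMeasurable
  have hcm : AEStronglyMeasurable (fun ω => ((1 + rnorm P 𝕜 y ω : ℝ) : 𝕜)) P :=
    (RCLike.measurable_ofReal.comp (measurable_const.add
      (rnorm P 𝕜 y).measurable)).aestronglyMeasurable
  set b : Ω →ₘ[P] 𝕜 := AEEqFun.mk _ hbm
  set c : Ω →ₘ[P] 𝕜 := AEEqFun.mk _ hcm
  have hb : ∀ᵐ ω ∂P, b ω = ((1 + rnorm P 𝕜 y ω : ℝ)⁻¹ : ℝ) := AEEqFun.coeFn_mk _ hbm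
  have hc : ∀ᵐ ω ∂P, c ω = ((1 + rnorm P 𝕜 y ω : ℝ) : 𝕜) := AEEqFun.coeFn_mk _ hcm
  have hbc : c * b = 1 := by
    refine AEEqFun.ext ?_
    filter_upwards [hb, hc, AEEqFun.coeFn_mul c b, AEEqFun.coeFn_one (μ := P) (β := 𝕜),
      ae_rnorm_nonneg P 𝕜 y] with ω h1 h2 h3 h4 h5
    rw [h3, h4, Pi.mul_apply, h1, h2, ← RCLike.ofReal_mul, mul_inv_cancel₀ (by positivity)]
    simp
  have hz : ∀ᵐ ω ∂P, rnorm P 𝕜 (b • y) ω ≤ 1 := by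
    filter_upwards [ae_rnorm_smul b y, hb, ae_rnorm_nonneg P 𝕜 y] with ω h1 h2 h3
    rw [h1, h2, RCLike.norm_ofReal, abs_of_nonneg (by positivity), inv_mul_le_one₀ (by positivity)]
    linarith
  set G : Lp 𝕜 2 P := (InnerProductSpace.toDual 𝕜 (Lp 𝕜 2 P)).symm (φ.comp (lpSmul A hz))
  have hG : ∀ h, φ (lpSmul A hz h) = ⟪G, h⟫_𝕜 := fun h => by
    rw [InnerProductSpace.toDual_symm_apply]; rfl
  set Gc : Ω →ₘ[P] 𝕜 := AEEqFun.comp conj RCLike.continuous_conj (G : Ω →ₘ[P] 𝕜)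
  have hGc : ∀ᵐ ω ∂P, Gc ω = conj (G ω) := AEEqFun.coeFn_comp _ _ _
  refine ⟨c * Gc, fun h hh => ?_⟩
  have hmem : MemLp (h * c : Ω →ₘ[P] 𝕜) 2 P := by
    refine MemLp.of_bound (h * c).aestronglyMeasurable 1 ?_
    filter_upwards [hh, AEEqFun.coeFn_mul h c, hc, ae_rnorm_nonneg P 𝕜 y] with ω h1 h2 h3 h4
    rw [h2, Pi.mul_apply, norm_mul, h3, RCLike.norm_ofReal, abs_of_nonneg (by positivity)]
    rwa [unitWeight, ← one_div, le_div_iff₀ (by positivity)] at h1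
  set k : Lp 𝕜 2 P := ⟨h * c, Lp.mem_Lp_iff_memLp.2 hmem⟩
  have hk : ((lpSmul A hz k : L2Space P 𝕜 E A) : E) = h • y := by
    change (h * c) • b • y = h • y
    rw [smul_smul, mul_assoc, hbc, mul_one]
  have hae : (fun ω => ⟪G ω, k ω⟫_𝕜) =ᵐ[P] fun ω => h ω * (c * Gc) ω := by
    filter_upwards [hGc, AEEqFun.coeFn_mul h c, AEEqFun.coeFn_mul c Gc] with ω h1 h2 h3
    have : k ω = (h * c : Ω →ₘ[P] 𝕜) ω := rfl
    rw [this, RCLike.inner_apply, h2, h3, Pi.mul_apply, Pi.mul_apply, h1, mul_assoc]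
  refine ⟨(L2.integrable_inner G k).congr hae, hk ▸ (lpSmul A hz k).2, ?_⟩
  rw [← integral_congr_ae hae, ← L2.inner_def, ← hG]
  congr 1
  exact Subtype.ext hk.symm

/-- By uniqueness of densities, they depend `L⁰`-linearly on the element of `E`. -/
theorem exists_linearMap_isDensity [IsProbabilityMeasure P] (φ : L2Space P 𝕜 E A →L[𝕜] 𝕜) :
    ∃ g : E →ₗ[Ω →ₘ[P] 𝕜] (Ω →ₘ[P] 𝕜), ∀ y, IsDensity φ y (g y) (unitWeight P 𝕜 y) := by
  choose g hg using exists_isDensity φ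
  refine ⟨{ toFun := g, map_add' := fun x y => ?_, map_smul' := fun ξ y => ?_ }, hg⟩
  · refine IsDensity.unique (φ := φ)
      (w := fun ω => unitWeight P 𝕜 (x + y) ω ⊓ (unitWeight P 𝕜 x ω ⊓ unitWeight P 𝕜 y ω))
      ((measurable_unitWeight (P := P) (𝕜 := 𝕜) (x + y)).inf
        ((measurable_unitWeight x).inf (measurable_unitWeight y))) ?_
      ((hg (x + y)).mono fun ω => inf_le_left)
      (IsDensity.add ((hg x).mono fun ω => inf_le_right.trans inf_le_left)
        ((hg y).mono fun ω => inf_le_right.trans inf_le_right))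
    filter_upwards [unitWeight_pos (P := P) (𝕜 := 𝕜) x, unitWeight_pos (P := P) (𝕜 := 𝕜) y,
      unitWeight_pos (P := P) (𝕜 := 𝕜) (x + y)] with ω h1 h2 h3
    exact lt_inf_iff.2 ⟨h3, lt_inf_iff.2 ⟨h1, h2⟩⟩
  · refine IsDensity.unique (φ := φ)
      (w := fun ω => unitWeight P 𝕜 (ξ • y) ω ⊓ (unitWeight P 𝕜 y ω / (1 + ‖ξ ω‖)))
      ((measurable_unitWeight (P := P) (𝕜 := 𝕜) (ξ • y)).inf
        ((measurable_unitWeight y).div (measurable_const.add ξ.measurable.norm))) ?_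
      ((hg (ξ • y)).mono fun ω => inf_le_left)
      (((hg y).smul ξ).mono fun ω => inf_le_right)
    filter_upwards [unitWeight_pos (P := P) (𝕜 := 𝕜) y,
      unitWeight_pos (P := P) (𝕜 := 𝕜) (ξ • y)] with ω h1 h2
    exact lt_inf_iff.2 ⟨h2, by positivity⟩

end Duality

/-! ### Convergence in probability and random weak convergence -/

section Topology

variable {Ω : Type*} [MeasurableSpace Ω] {P : Measure Ω} [IsProbabilityMeasure P]
  {𝕜 : Type*} [RCLike 𝕜]
  {E : Type*} [AddCommGroup E] [Module (Ω →ₘ[P] 𝕜) E] [RNModule P 𝕜 E]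

variable (P) in
theorem probReal_le_eq_one_sub (ξ : Ω →ₘ[P] ℝ) (ε : ℝ) :
    P.real {ω | ε ≤ ξ ω} = 1 - P.real {ω | ξ ω < ε} := by
  have hm : MeasurableSet {ω | ξ ω < ε} := measurableSet_lt ξ.measurable measurable_const
  rw [← probReal_compl_eq_one_sub hm]
  congr 1
  ext ω
  simp

theorem epsLam_hasBasis_zero : (@nhds E (epsLamTopology P 𝕜 E) 0).HasBasis
    (fun p : ℝ × ℝ => 0 < p.1 ∧ 0 < p.2 ∧ p.2 < 1) (fun p => epsLamNhd P 𝕜 E p.1 p.2) := by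
  refine ((epsLamBasis P 𝕜 E).nhds_zero_hasBasis).to_hasBasis ?_ ?_
  · rintro U ⟨ε, l, hε, hl, hl1, rfl⟩
    exact ⟨(ε, l), ⟨hε, hl, hl1⟩, subset_rfl⟩
  · rintro ⟨ε, l⟩ ⟨hε, hl, hl1⟩
    exact ⟨_, ⟨ε, l, hε, hl, hl1, rfl⟩, subset_rfl⟩

/-- Convergence in the `(ε, lam)`-topology is convergence in probability of the norms. -/
theorem tendsto_epsLam_iff {u : ℕ → E} {x : E} :
    Tendsto u atTop (@nhds E (epsLamTopology P 𝕜 E) x) ↔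
      ∀ ε : ℝ, 0 < ε → Tendsto (fun n => P.real {ω | ε ≤ rnorm P 𝕜 (u n - x) ω}) atTop (𝓝 0) := by
  let := epsLamTopology P 𝕜 E
  have : IsTopologicalAddGroup E := (epsLamBasis P 𝕜 E).isTopologicalAddGroup
  rw [← tendsto_sub_nhds_zero_iff, epsLam_hasBasis_zero.tendsto_right_iff]
  constructor
  · intro h ε hε
    refine tendsto_order.2 ⟨fun a ha => Eventually.of_forall fun n =>
      ha.trans_le measureReal_nonneg, fun a ha => ?_⟩
    filter_upwards [h (ε, min a (1 / 2)) ⟨hε, lt_min ha (by norm_num),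
      (min_le_right _ _).trans_lt (by norm_num)⟩] with n hn
    rw [probReal_le_eq_one_sub]
    have : 1 - min a (1 / 2) < P.real {ω | rnorm P 𝕜 (u n - x) ω < ε} := hn
    have := min_le_left a (1 / 2)
    linarith
  · rintro h ⟨ε, l⟩ ⟨hε, hl, -⟩
    filter_upwards [(h ε hε).eventually_lt_const hl] with n hn
    rw [probReal_le_eq_one_sub] at hn
    change 1 - l < P.real {ω | rnorm P 𝕜 (u n - x) ω < ε}
    linarith

theorem mem_of_isClosed_epsLam {G : Set E} (hG : IsClosed[epsLamTopology P 𝕜 E] G) {x : E}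
    (h : ∀ ε : ℝ, 0 < ε → ∃ y ∈ G, P.real {ω | ε ≤ rnorm P 𝕜 (y - x) ω} ≤ ε) : x ∈ G := by
  let := epsLamTopology P 𝕜 E
  choose y hyG hy using fun n : ℕ => h (1 / (n + 1)) Nat.one_div_pos_of_nat
  refine hG.mem_of_tendsto (b := atTop) (tendsto_epsLam_iff.2 fun ε hε => ?_)
    (Eventually.of_forall hyG)
  have h0 := tendsto_one_div_add_atTop_nhds_zero_nat (𝕜 := ℝ)
  refine squeeze_zero' (Eventually.of_forall fun n => measureReal_nonneg) ?_ h0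
  filter_upwards [h0.eventually_le_const hε] with n hn
  exact (measureReal_mono fun ω hω => hn.trans hω).trans (hy n)

theorem tendsto_of_tendsto_randomWeak {u : ℕ → E} {x : E}
    (hu : Tendsto u atTop (@nhds E (randomWeakTopology P 𝕜 E) x)) (g : RandomDual P 𝕜 E) :
    Tendsto (fun n => g.1 (u n)) atTop (@nhds _ (epsLamTopology P 𝕜 (Ω →ₘ[P] 𝕜)) (g.1 x)) := by
  let := epsLamTopology P 𝕜 (Ω →ₘ[P] 𝕜)
  let := randomWeakTopology P 𝕜 E
  have hc : Continuous g.1 := continuous_iInf_dom (i := g) continuous_induced_dom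
  exact (hc.tendsto x).comp hu

end Topology

section WeakConvergence

variable {Ω : Type*} [MeasurableSpace Ω] {𝕜 : Type*} [RCLike 𝕜]

/-- The class of the function equal to `c` on `B` and to `0` elsewhere. -/
noncomputable def indL0 (P : Measure Ω) (𝕜 : Type*) [RCLike 𝕜] {B : Set Ω}
    (hB : MeasurableSet B) (c : ℝ) : Ω →ₘ[P] 𝕜 :=
  AEEqFun.mk (B.indicator fun _ => (c : 𝕜)) (aestronglyMeasurable_const.indicator hB)

theorem coeFn_indL0 {P : Measure Ω} {B : Set Ω} (hB : MeasurableSet B) (c : ℝ) :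
    ∀ᵐ ω ∂P, indL0 P 𝕜 hB c ω = B.indicator (fun _ => (c : 𝕜)) ω :=
  AEEqFun.coeFn_mk _ _

variable {P : Measure Ω} [IsProbabilityMeasure P]
  {E : Type*} [AddCommGroup E] [Module (Ω →ₘ[P] 𝕜) E] [RNModule P 𝕜 E] {A : Set Ω}

/-- Small elements have small densities, in probability: Markov's inequality, after testing
against a coefficient supported where `‖y‖ < a`. -/
theorem IsDensity.measure_le {φ : L2Space P 𝕜 E A →L[𝕜] 𝕜} {y : E} {g : Ω →ₘ[P] 𝕜}
    (hg : IsDensity φ y g (unitWeight P 𝕜 y)) {a ε : ℝ} (ha : 0 < a) (ha1 : a ≤ 1) (hε : 0 < ε) :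
    P.real {ω | ε ≤ ‖g ω‖} ≤
      P.real {ω | a ≤ rnorm P 𝕜 y ω} + ‖φ‖ * a * (2 * (1 + ε) / ε ^ 2) := by
  set S : Set Ω := {ω | rnorm P 𝕜 y ω < a}
  have hS : MeasurableSet S := measurableSet_lt (rnorm P 𝕜 y).measurable measurable_const
  set w : Ω → ℝ := S.indicator (unitWeight P 𝕜 y)
  have hw : Measurable w := (measurable_unitWeight y).indicator hS
  have hw0 : ∀ᵐ ω ∂P, 0 ≤ w ω := by
    filter_upwards [unitWeight_pos (P := P) (𝕜 := 𝕜) y] with ω h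
    exact Set.indicator_apply_nonneg fun _ => h.le
  have hm := aestronglyMeasurable_testCoeff hw g
  set h : Ω →ₘ[P] 𝕜 := AEEqFun.mk _ hm
  have hh : ∀ᵐ ω ∂P, h ω = testCoeff w g ω := AEEqFun.coeFn_mk _ hm
  obtain ⟨i, m, e⟩ := hg h (by
    filter_upwards [hh, hw0, unitWeight_pos (P := P) (𝕜 := 𝕜) y] with ω h1 h2 h3
    rw [h1]
    exact (norm_testCoeff_le g h2).trans (Set.indicator_le_self' (fun _ _ => h3.le) ω))
  have hae : (fun ω => h ω * g ω) =ᵐ[P]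
      fun ω => ((w ω * (‖g ω‖ ^ 2 / (1 + ‖g ω‖)) : ℝ) : 𝕜) := by
    filter_upwards [hh] with ω h1
    rw [← testCoeff_mul_self, h1]
  have hi : Integrable (fun ω => w ω * (‖g ω‖ ^ 2 / (1 + ‖g ω‖))) P := by
    have := (i.congr hae).re
    simpa only [RCLike.ofReal_re] using this
  have hnn : ∀ᵐ ω ∂P, 0 ≤ w ω * (‖g ω‖ ^ 2 / (1 + ‖g ω‖)) := by
    filter_upwards [hw0] with ω h1
    positivity
  have hint : ∫ ω, w ω * (‖g ω‖ ^ 2 / (1 + ‖g ω‖)) ∂P ≤ ‖φ‖ * a := by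
    have h1 : ‖φ ⟨h • y, m⟩‖ ≤ ‖φ‖ * a := by
      refine φ.le_opNorm_of_le (L2Space.norm_le_of_bounded _ ha.le (ae_restrict_of_ae ?_))
      filter_upwards [ae_rnorm_smul h y, hh, hw0, ae_rnorm_nonneg P 𝕜 y] with ω h1 h2 h3 h4
      rw [h1, h2]
      have h5 := norm_testCoeff_le g h3
      by_cases hω : ω ∈ S
      · have h6 : w ω ≤ 1 := by
          have h8 : w ω = (1 + rnorm P 𝕜 y ω)⁻¹ := Set.indicator_of_mem hω _
          rw [h8]
          exact inv_le_one_of_one_le₀ (by linarith)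
        have h7 : rnorm P 𝕜 y ω < a := hω
        nlinarith [norm_nonneg (testCoeff w g ω)]
      · have h6 : w ω = 0 := Set.indicator_of_notMem hω _
        rw [h6] at h5
        rw [le_antisymm h5 (norm_nonneg _), zero_mul]
        exact ha.le
    rw [e, integral_congr_ae hae, integral_ofReal, RCLike.norm_ofReal] at h1
    exact (le_abs_self _).trans h1
  have hmarkov := mul_meas_ge_le_integral_of_nonneg hnn hi (ε ^ 2 / (2 * (1 + ε)))
  have hsub : {ω | ε ≤ ‖g ω‖} ≤ᵐ[P] ({ω | a ≤ rnorm P 𝕜 y ω} ∪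
      {ω | ε ^ 2 / (2 * (1 + ε)) ≤ w ω * (‖g ω‖ ^ 2 / (1 + ‖g ω‖))} : Set Ω) := by
    filter_upwards [ae_rnorm_nonneg P 𝕜 y] with ω h1 h2
    have h2' : ε ≤ ‖g ω‖ := h2
    by_cases hω : ω ∈ S
    · right
      have h3 : rnorm P 𝕜 y ω < a := hω
      have h4 : 1 / 2 ≤ w ω := by
        have : w ω = (1 + rnorm P 𝕜 y ω)⁻¹ := Set.indicator_of_mem hω _
        rw [this, ← one_div]
        gcongr
        linarith
      have h5 : ε ^ 2 / (1 + ε) ≤ ‖g ω‖ ^ 2 / (1 + ‖g ω‖) := by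
        rw [div_le_div_iff₀ (by positivity) (by positivity)]
        have : ε * (ε * ‖g ω‖) ≤ ‖g ω‖ * (ε * ‖g ω‖) := by gcongr
        nlinarith
      change ε ^ 2 / (2 * (1 + ε)) ≤ _
      calc ε ^ 2 / (2 * (1 + ε)) = 1 / 2 * (ε ^ 2 / (1 + ε)) := by field_simp
        _ ≤ _ := by gcongr
    · left
      exact not_lt.1 (show ¬ rnorm P 𝕜 y ω < a from hω)
  have h1 : P.real {ω | ε ^ 2 / (2 * (1 + ε)) ≤ w ω * (‖g ω‖ ^ 2 / (1 + ‖g ω‖))} ≤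
      ‖φ‖ * a * (2 * (1 + ε) / ε ^ 2) := by
    have h2 := hmarkov.trans hint
    rw [← le_div_iff₀' (by positivity)] at h2
    refine h2.trans (le_of_eq ?_)
    rw [div_div_eq_mul_div, mul_div_assoc]
  calc P.real {ω | ε ≤ ‖g ω‖} ≤ _ := ENNReal.toReal_mono (measure_ne_top _ _) (measure_mono_ae hsub)
    _ ≤ _ := measureReal_union_le _ _
    _ ≤ _ := by gcongr

theorem continuous_of_isDensity {φ : L2Space P 𝕜 E A →L[𝕜] 𝕜}
    {g : E →ₗ[Ω →ₘ[P] 𝕜] (Ω →ₘ[P] 𝕜)} (hg : ∀ y, IsDensity φ y (g y) (unitWeight P 𝕜 y)) :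
    Continuous[epsLamTopology P 𝕜 E, epsLamTopology P 𝕜 (Ω →ₘ[P] 𝕜)] g := by
  let := epsLamTopology P 𝕜 E
  let := epsLamTopology P 𝕜 (Ω →ₘ[P] 𝕜)
  have : IsTopologicalAddGroup E := (epsLamBasis P 𝕜 E).isTopologicalAddGroup
  have : IsTopologicalAddGroup (Ω →ₘ[P] 𝕜) :=
    (epsLamBasis P 𝕜 (Ω →ₘ[P] 𝕜)).isTopologicalAddGroup
  refine continuous_of_continuousAt_zero g ?_
  rw [ContinuousAt, map_zero, epsLam_hasBasis_zero.tendsto_iff epsLam_hasBasis_zero]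
  rintro ⟨ε, l⟩ ⟨hε, hl, hl1⟩
  have hlim : Tendsto (fun a : ℝ => ‖φ‖ * a * (2 * (1 + ε) / ε ^ 2)) (𝓝[>] 0) (𝓝 0) := by
    have : Continuous (fun a : ℝ => ‖φ‖ * a * (2 * (1 + ε) / ε ^ 2)) := by fun_prop
    simpa using (this.tendsto 0).mono_left (nhdsWithin_le_nhds (s := Set.Ioi 0))
  obtain ⟨a, ha, ha0, ha1⟩ := ((hlim.eventually_lt_const (half_pos hl)).and
    (Ioo_mem_nhdsGT (show (0 : ℝ) < 1 by norm_num))).exists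
  refine ⟨(a, l / 2), ⟨ha0, half_pos hl, by linarith⟩, fun y hy => ?_⟩
  have hy' : 1 - l / 2 < P.real {ω | rnorm P 𝕜 y ω < a} := hy
  have h1 := (hg y).measure_le ha0 ha1.le hε
  rw [probReal_le_eq_one_sub] at h1
  have h2 : P.real {ω | ε ≤ ‖g y ω‖} = P.real {ω | ε ≤ rnorm P 𝕜 (g y) ω} := by
    refine measureReal_congr ?_
    filter_upwards [coeFn_L0abs (g y)] with ω h
    change (ε ≤ ‖g y ω‖) = (ε ≤ L0abs (g y) ω)
    rw [h]
  rw [h2, probReal_le_eq_one_sub] at h1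
  change 1 - l < P.real {ω | rnorm P 𝕜 (g y) ω < ε}
  linarith

/-- On bounded elements, `φ` is controlled by the size of the density in probability: `z` is split
into its part `y` on the set where the density is below `ε` and the rest. -/
theorem IsDensity.norm_apply_le {φ : L2Space P 𝕜 E A →L[𝕜] 𝕜} (hA : MeasurableSet A)
    {z : L2Space P 𝕜 E A}
    {g : Ω →ₘ[P] 𝕜} (hg : IsDensity φ z.1 g (unitWeight P 𝕜 z.1)) {K ε : ℝ} (hK : 0 ≤ K)
    (hε : 0 < ε) (hz : ∀ᵐ ω ∂P.restrict A, rnorm P 𝕜 z.1 ω ≤ K) :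
    ‖φ z‖ ≤ ε + ‖φ‖ * √(K ^ 2 * P.real {ω | ε ≤ ‖g ω‖}) := by
  have hT : MeasurableSet {ω | ε ≤ ‖g ω‖} := measurableSet_le measurable_const g.measurable.norm
  set T := {ω | ε ≤ ‖g ω‖}
  have hB : MeasurableSet (A \ T) := hA.diff hT
  set h := indL0 P 𝕜 hB (1 + K)⁻¹
  have hh := coeFn_indL0 (P := P) (𝕜 := 𝕜) hB (1 + K)⁻¹
  have hzA := (ae_restrict_iff' hA).1 hz
  have hc : ‖(((1 + K)⁻¹ : ℝ) : 𝕜)‖ = (1 + K)⁻¹ := by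
    rw [RCLike.norm_ofReal, abs_of_nonneg (by positivity)]
  obtain ⟨i, m, e⟩ := hg h (by
    filter_upwards [hh, hzA, ae_rnorm_nonneg P 𝕜 z.1] with ω h1 h2 h3
    rw [h1]
    by_cases hω : ω ∈ A \ T
    · rw [Set.indicator_of_mem hω, hc]
      unfold unitWeight
      gcongr
      exact h2 hω.1
    · rw [Set.indicator_of_notMem hω, norm_zero]
      unfold unitWeight
      positivity)
  have h1 : ‖φ ⟨h • z.1, m⟩‖ ≤ (1 + K)⁻¹ * ε := by
    rw [e]
    refine (norm_integral_le_of_norm_le_const (C := (1 + K)⁻¹ * ε) ?_).trans (by simp)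
    filter_upwards [hh] with ω h1
    rw [norm_mul, h1]
    by_cases hω : ω ∈ A \ T
    · rw [Set.indicator_of_mem hω, hc]
      have : ‖g ω‖ < ε := not_le.1 hω.2
      gcongr
    · rw [Set.indicator_of_notMem hω, norm_zero, zero_mul]
      positivity
  set y : L2Space P 𝕜 E A := ((1 + K : ℝ) : 𝕜) • ⟨h • z.1, m⟩ with hy
  have h2 : ‖φ y‖ ≤ ε := by
    rw [hy, map_smul, norm_smul, RCLike.norm_ofReal, abs_of_nonneg (by positivity)]
    calc (1 + K) * ‖φ ⟨h • z.1, m⟩‖ ≤ (1 + K) * ((1 + K)⁻¹ * ε) := by gcongr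
      _ = ε := by field_simp
  have hdiff : ∀ᵐ ω ∂P, ω ∈ A → rnorm P 𝕜 (z - y).1 ω = T.indicator (fun _ => (1 : ℝ)) ω *
      rnorm P 𝕜 z.1 ω := by
    have e1 : (z - y).1 = (1 - constHom P 𝕜 ((1 + K : ℝ) : 𝕜) * h) • z.1 := by
      rw [sub_smul, one_smul, mul_smul]; rfl
    rw [e1]
    filter_upwards [ae_rnorm_smul (1 - constHom P 𝕜 ((1 + K : ℝ) : 𝕜) * h) z.1, hh,
      AEEqFun.coeFn_sub 1 (constHom P 𝕜 ((1 + K : ℝ) : 𝕜) * h),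
      AEEqFun.coeFn_mul (constHom P 𝕜 ((1 + K : ℝ) : 𝕜)) h,
      AEEqFun.coeFn_one (μ := P) (β := 𝕜), coeFn_constHom P 𝕜 ((1 + K : ℝ) : 𝕜)]
      with ω h1 h2 h3 h4 h5 h6 hω
    rw [h1, h3, Pi.sub_apply, h4, h5, Pi.mul_apply, h6, h2, Pi.one_apply]
    by_cases hT : ω ∈ T
    · rw [Set.indicator_of_notMem (fun h => h.2 hT), Set.indicator_of_mem hT]
      simp
    · rw [Set.indicator_of_mem (show ω ∈ A \ T from ⟨hω, hT⟩), Set.indicator_of_notMem hT,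
        ← RCLike.ofReal_mul,
        mul_inv_cancel₀ (by positivity)]
      simp
  have h3 : ‖z - y‖ ^ 2 ≤ 0 ^ 2 + K ^ 2 * P.real T := by
    have hd := (ae_restrict_iff' hA).2 hdiff
    refine L2Space.norm_sq_le _ hT ?_ ?_
    · filter_upwards [hd, hz] with ω h1 h2
      rw [h1]
      by_cases hT : ω ∈ T
      · rw [Set.indicator_of_mem hT, one_mul]; exact h2
      · rw [Set.indicator_of_notMem hT, zero_mul]; exact hK
    · filter_upwards [hd] with ω h1 hT
      rw [h1, Set.indicator_of_notMem hT, zero_mul]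
  have h4 : ‖z - y‖ ≤ √(K ^ 2 * P.real T) := by
    refine Real.le_sqrt_of_sq_le ?_
    linarith
  calc ‖φ z‖ = ‖φ y + φ (z - y)‖ := by rw [← map_add, add_sub_cancel]
    _ ≤ ‖φ y‖ + ‖φ (z - y)‖ := norm_add_le _ _
    _ ≤ _ := add_le_add h2 (φ.le_opNorm_of_le h4)

/-- On sets where the sequence is bounded, random weak convergence gives weak convergence in
`L²`. -/
theorem weaklyTendsto_of_tendsto_randomWeak (hA : MeasurableSet A) {u : ℕ → L2Space P 𝕜 E A}
    {x : L2Space P 𝕜 E A}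
    (hu : Tendsto (fun n => (u n).1) atTop (@nhds E (randomWeakTopology P 𝕜 E) x.1)) {K : ℝ}
    (hK0 : 0 ≤ K) (hK : ∀ n, ∀ᵐ ω ∂P.restrict A, rnorm P 𝕜 ((u n).1 - x.1) ω ≤ K) :
    WeaklyTendsto 𝕜 u x := by
  intro φ
  obtain ⟨g, hg⟩ := exists_linearMap_isDensity φ
  have hgu := tendsto_epsLam_iff.1
    (tendsto_of_tendsto_randomWeak hu ⟨g, continuous_of_isDensity hg⟩)
  rw [← tendsto_sub_nhds_zero_iff]
  rw [Metric.tendsto_atTop]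
  intro δ hδ
  have h1 := hgu (δ / 2) (half_pos hδ)
  have h2 : Tendsto (fun n => δ / 2 + ‖φ‖ * √(K ^ 2 *
      P.real {ω | δ / 2 ≤ rnorm P 𝕜 (g (u n).1 - g x.1) ω})) atTop (𝓝 (δ / 2)) := by
    have := (((h1.const_mul (K ^ 2)).sqrt).const_mul ‖φ‖).const_add (δ / 2)
    simpa using this
  obtain ⟨N, hN⟩ := eventually_atTop.1 (h2.eventually_lt_const (half_lt_self hδ))
  refine ⟨N, fun n hn => ?_⟩
  rw [dist_zero_right, ← map_sub]
  refine lt_of_le_of_lt ?_ (hN n hn)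
  refine (IsDensity.norm_apply_le hA (z := u n - x) (hg _) hK0 (half_pos hδ) (hK n)).trans
    (le_of_eq ?_)
  congr 4
  refine measureReal_congr ?_
  have e : g (u n).1 - g x.1 = g (u n - x).1 := (map_sub g _ _).symm
  rw [e]
  filter_upwards [coeFn_L0abs (g (u n - x).1)] with ω h
  change (δ / 2 ≤ ‖g (u n - x).1 ω‖) = (δ / 2 ≤ L0abs (g (u n - x).1) ω)
  rw [h]

end WeakConvergence

/-! ### Localization -/

section Midpoint

variable {Ω : Type*} [MeasurableSpace Ω] {P : Measure Ω} {𝕜 : Type*} [RCLike 𝕜]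
  {E : Type*} [AddCommGroup E] [Module (Ω →ₘ[P] 𝕜) E]

theorem IsL0Convex.midpoint_mem {G : Set E} (hG : IsL0Convex P 𝕜 G) {x y : E} (hx : x ∈ G)
    (hy : y ∈ G) : constHom P 𝕜 2⁻¹ • (x + y) ∈ G := by
  have h0 : (0 : Ω →ₘ[P] ℝ) ≤ AEEqFun.const Ω 2⁻¹ := by
    rw [← AEEqFun.coeFn_le]
    filter_upwards [AEEqFun.coeFn_zero (μ := P) (β := ℝ),
      AEEqFun.coeFn_const Ω (μ := P) (2⁻¹ : ℝ)] with ω h1 h2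
    rw [h1, h2]
    simp
  have h1 : (AEEqFun.const Ω 2⁻¹ : Ω →ₘ[P] ℝ) + AEEqFun.const Ω 2⁻¹ = 1 := by
    refine AEEqFun.ext ?_
    filter_upwards [AEEqFun.coeFn_add (AEEqFun.const Ω 2⁻¹ : Ω →ₘ[P] ℝ) (AEEqFun.const Ω 2⁻¹),
      AEEqFun.coeFn_const Ω (μ := P) (2⁻¹ : ℝ), AEEqFun.coeFn_one (μ := P) (β := ℝ)]
      with ω h1 h2 h3
    rw [h1, h3, Pi.add_apply, h2]
    norm_num
  have h2 : L0ofReal 𝕜 (AEEqFun.const Ω 2⁻¹ : Ω →ₘ[P] ℝ) = constHom P 𝕜 2⁻¹ := by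
    refine AEEqFun.ext ?_
    filter_upwards [coeFn_L0ofReal (𝕜 := 𝕜) (AEEqFun.const Ω 2⁻¹ : Ω →ₘ[P] ℝ),
      AEEqFun.coeFn_const Ω (μ := P) (2⁻¹ : ℝ), coeFn_constHom P 𝕜 2⁻¹] with ω h1 h2 h3
    rw [h1, h2, h3]
    simp only [Function.const_apply, RCLike.ofReal_inv, RCLike.ofReal_ofNat]
  have := hG.2 x hx y hy _ _ h0 h0 h1
  rwa [h2, ← smul_add] at this

end Midpoint

section Localization

variable {Ω : Type*} [MeasurableSpace Ω] {P : Measure Ω} [IsProbabilityMeasure P]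

theorem exists_measure_le_bounded_compl {b : Ω → ℝ} (hb : Measurable b) {τ : ℝ} (hτ : 0 < τ) :
    ∃ t, MeasurableSet t ∧ P t ≤ ENNReal.ofReal τ ∧ ∃ N : ℝ, ∀ ω ∉ t, b ω ≤ N := by
  -- Egorov's theorem for the sequence `b / n`
  obtain ⟨t, ht, hPt, hu⟩ := tendstoUniformlyOn_of_ae_tendsto' (μ := P)
    (f := fun n : ℕ => fun ω => b ω / n) (g := fun _ => 0)
    (fun n => (hb.div_const _).stronglyMeasurable) stronglyMeasurable_const
    (Eventually.of_forall fun ω => tendsto_const_div_atTop_nhds_zero_nat (b ω)) hτ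
  obtain ⟨n, hn, hn0⟩ :=
    ((Metric.tendstoUniformlyOn_iff.1 hu 1 one_pos).and (eventually_gt_atTop 0)).exists
  refine ⟨t, ht, hPt, n, fun ω hω => ?_⟩
  have h := hn ω hω
  have hn' : (0 : ℝ) < n := Nat.cast_pos.2 hn0
  rw [dist_zero_left, Real.norm_eq_abs] at h
  have := (le_abs_self _).trans h.le
  rwa [div_le_one hn'] at this

theorem exists_measurableSet_bounded_tendstoUniformlyOn {b : Ω → ℝ} (hb : Measurable b)
    {η : ℕ → Ω →ₘ[P] ℝ} (hη : ∀ᵐ ω ∂P, Tendsto (fun m => η m ω) atTop (𝓝 1)) {τ : ℝ}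
    (hτ : 0 < τ) :
    ∃ A, MeasurableSet A ∧ P.real Aᶜ ≤ τ ∧ (∃ N : ℝ, ∀ ω ∈ A, b ω ≤ N) ∧
      TendstoUniformlyOn (fun m => ⇑(η m)) (fun _ => 1) atTop A := by
  obtain ⟨t, ht, hPt, N, hN⟩ := exists_measure_le_bounded_compl (P := P) hb (half_pos hτ)
  obtain ⟨s, hs, hPs, hu⟩ := tendstoUniformlyOn_of_ae_tendsto' (μ := P) (f := fun m => ⇑(η m))
    (fun m => (η m).stronglyMeasurable) stronglyMeasurable_const hη (half_pos hτ)
  refine ⟨tᶜ ∩ sᶜ, ht.compl.inter hs.compl, ?_, ⟨N, fun ω hω => hN ω hω.1⟩,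
    hu.mono Set.inter_subset_right⟩
  rw [Set.compl_inter, compl_compl, compl_compl]
  have h1 : P.real t ≤ τ / 2 := ENNReal.toReal_le_of_le_ofReal (half_pos hτ).le hPt
  have h2 : P.real s ≤ τ / 2 := ENNReal.toReal_le_of_le_ofReal (half_pos hτ).le hPs
  linarith [measureReal_union_le (μ := P) t s]

variable {𝕜 : Type*} [RCLike 𝕜]
  {E : Type*} [AddCommGroup E] [Module (Ω →ₘ[P] 𝕜) E] [RNModule P 𝕜 E]

/-- Chebyshev's inequality on `A`. -/
theorem L2Space.measure_le {A : Set Ω} (hA : MeasurableSet A) (z : L2Space P 𝕜 E A) {ε : ℝ}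
    (hε : 0 < ε) : P.real {ω | ε ≤ rnorm P 𝕜 z.1 ω} ≤ P.real Aᶜ + ‖z‖ ^ 2 / ε ^ 2 := by
  have hm := mul_meas_ge_le_integral_of_nonneg (μ := P.restrict A)
    (Eventually.of_forall fun ω => sq_nonneg (rnorm P 𝕜 z.1 ω)) z.integrable_sq (ε ^ 2)
  rw [← L2Space.norm_sq, ← le_div_iff₀' (by positivity)] at hm
  have hsub : {ω | ε ≤ rnorm P 𝕜 z.1 ω} ⊆
      Aᶜ ∪ ({ω | ε ^ 2 ≤ rnorm P 𝕜 z.1 ω ^ 2} ∩ A) := by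
    intro ω hω
    by_cases h : ω ∈ A
    · have hω' : ε ≤ rnorm P 𝕜 z.1 ω := hω
      exact Or.inr ⟨by change ε ^ 2 ≤ _; gcongr, h⟩
    · exact Or.inl h
  rw [measureReal_restrict_apply' hA] at hm
  exact (measureReal_mono hsub).trans ((measureReal_union_le _ _).trans (by gcongr))

/-- Demiclosedness on a set `A` where the data are uniformly controlled. -/
theorem demiclosed_on (hE : IsRandomUniformlyConvex P 𝕜 E) {G : Set E} (hG : IsL0Convex P 𝕜 G)
    {f : G → G} {A : Set Ω} (hA : MeasurableSet A) {N : ℝ} (hN : 0 ≤ N)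
    (hGN : ∀ y ∈ G, ∀ᵐ ω ∂P.restrict A, rnorm P 𝕜 y ω ≤ N)
    (hL : ∀ a b : G, ∀ᵐ ω ∂P.restrict A,
      rnorm P 𝕜 ((f a : E) - f b) ω ≤ N * rnorm P 𝕜 ((a : E) - b) ω)
    (hf : ∀ ρ : ℝ, 0 < ρ → ∃ m₀ : ℕ, ∀ m ≥ m₀, ∀ a b : G, ∀ᵐ ω ∂P.restrict A,
      rnorm P 𝕜 ((f^[m] a : E) - f^[m] b) ω ≤ (1 + ρ) * rnorm P 𝕜 ((a : E) - b) ω)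
    {u : ℕ → G} {x : E} (hxN : ∀ᵐ ω ∂P.restrict A, rnorm P 𝕜 x ω ≤ N)
    (hux : Tendsto (fun n => (u n : E)) atTop (@nhds E (randomWeakTopology P 𝕜 E) x))
    (huf : Tendsto (fun n => (u n : E) - f (u n)) atTop (@nhds E (epsLamTopology P 𝕜 E) 0)) :
    (∀ τ : ℝ, 0 < τ → ∃ y : G, ∃ z : L2Space P 𝕜 E A, z.1 = y - x ∧ ‖z‖ ≤ τ) ∧
      ∀ hx : x ∈ G, ∀ᵐ ω ∂P.restrict A, rnorm P 𝕜 ((f ⟨x, hx⟩ : E) - x) ω = 0 := by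
  let e : G → L2Space P 𝕜 E A := fun a => ⟨a, sqIntegrableOn_of_bounded 𝕜 (hGN a a.2)⟩
  let xL : L2Space P 𝕜 E A := ⟨x, sqIntegrableOn_of_bounded 𝕜 hxN⟩
  have hsub : ∀ a b : E, (∀ᵐ ω ∂P.restrict A, rnorm P 𝕜 a ω ≤ N) →
      (∀ᵐ ω ∂P.restrict A, rnorm P 𝕜 b ω ≤ N) →
      ∀ᵐ ω ∂P.restrict A, rnorm P 𝕜 (a - b) ω ≤ 2 * N + 1 := fun a b ha hb => by
    filter_upwards [ha, hb, ae_restrict_of_ae (ae_rnorm_sub_le P 𝕜 a b)] with ω h1 h2 h3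
    linarith
  have hR : 0 < 2 * N + 1 := by positivity
  have he : ∀ a b, ‖e a - e b‖ ≤ 2 * N + 1 := fun a b =>
    L2Space.norm_le_of_bounded _ hR.le (hsub _ _ (hGN a a.2) (hGN b b.2))
  have hmid : ∀ a b, ∃ c, e c = (2⁻¹ : 𝕜) • (e a + e b) := fun a b =>
    ⟨⟨_, hG.midpoint_mem a.2 b.2⟩, Subtype.ext rfl⟩
  have hfe : ∀ ρ : ℝ, 0 < ρ → ∃ m₀ : ℕ, ∀ m ≥ m₀, ∀ a b,
      ‖e (f^[m] a) - e (f^[m] b)‖ ≤ (1 + ρ) * ‖e a - e b‖ := fun ρ hρ => by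
    obtain ⟨m₀, h⟩ := hf ρ hρ
    exact ⟨m₀, fun m hm a b => L2Space.norm_le_mul _ _ (by positivity) (h m hm a b)⟩
  have hLe : ∀ a b, ‖e (f a) - e (f b)‖ ≤ N * ‖e a - e b‖ := fun a b =>
    L2Space.norm_le_mul _ _ hN (hL a b)
  have hu : AsymptoticallyFixed e f u := by
    refine asymptoticallyFixed_of_tendsto hLe ?_
    have hP := tendsto_epsLam_iff.1 huf
    rw [Metric.tendsto_atTop]
    intro ε hε
    have h1 : Tendsto (fun n => (ε / 2) ^ 2 + (2 * N + 1) ^ 2 *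
        P.real {ω | ε / 2 ≤ rnorm P 𝕜 ((u n : E) - f (u n) - 0) ω}) atTop (𝓝 ((ε / 2) ^ 2)) := by
      simpa using ((hP (ε / 2) (half_pos hε)).const_mul ((2 * N + 1) ^ 2)).const_add ((ε / 2) ^ 2)
    obtain ⟨n₀, hn₀⟩ := eventually_atTop.1 (h1.eventually_lt_const
      (show (ε / 2) ^ 2 < ε ^ 2 by gcongr; linarith))
    refine ⟨n₀, fun n hn => ?_⟩
    rw [dist_zero_right, norm_norm]
    refine lt_of_pow_lt_pow_left₀ 2 hε.le (lt_of_le_of_lt ?_ (hn₀ n hn))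
    refine L2Space.norm_sq_le _ (measurableSet_le measurable_const
      (rnorm P 𝕜 ((u n : E) - f (u n) - 0)).measurable)
      (hsub _ _ (hGN _ (u n).2) (hGN _ (f (u n)).2)) (Eventually.of_forall fun ω hω => ?_)
    have hω' : ¬ ε / 2 ≤ rnorm P 𝕜 ((u n : E) - f (u n) - 0) ω := hω
    rw [sub_zero, not_le] at hω'
    exact hω'.le
  have hX := L2Space.approxParallelogram A hE
  have hweak : WeaklyTendsto 𝕜 (fun n => e (u n)) xL :=
    weaklyTendsto_of_tendsto_randomWeak hA hux hR.le fun n => hsub _ _ (hGN _ (u n).2) hxN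
  refine ⟨fun τ hτ => ?_, fun hx => ?_⟩
  · obtain ⟨v, -, hv⟩ := exists_asymptoticallyFixed_near_weak_limit (𝕜 := 𝕜) hX hR he
      (fun a => L2Space.norm_le_of_bounded _ hR.le (hsub _ _ (hGN a a.2) hxN)) hmid hfe hu hweak hτ
    obtain ⟨n, hn⟩ := hv.exists
    exact ⟨v n, e (v n) - xL, rfl, hn⟩
  · have h0 : ‖e (f ⟨x, hx⟩) - e ⟨x, hx⟩‖ = 0 :=
      norm_map_sub_self_eq_zero_of_weak_limit (𝕜 := 𝕜) hX hR he hmid hLe hfe hu hweak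
    have h1 := L2Space.norm_sq (e (f ⟨x, hx⟩) - e ⟨x, hx⟩)
    rw [h0, zero_pow two_ne_zero, eq_comm, integral_eq_zero_iff_of_nonneg
      (fun ω => sq_nonneg _) (L2Space.integrable_sq _)] at h1
    filter_upwards [h1] with ω hω
    exact (pow_eq_zero_iff two_ne_zero).1 hω

end Localization

end RandomNormed

theorem theorem2p4 {Ω : Type*} [MeasurableSpace Ω] (P : Measure Ω) [IsProbabilityMeasure P]
    (𝕜 : Type*) [RCLike 𝕜]
    (E : Type*) [AddCommGroup E] [Module (Ω →ₘ[P] 𝕜) E] [RNModule P 𝕜 E]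
    (hfull : HasFullSupport P 𝕜 E)
    (hcomplete : IsCompleteRN P 𝕜 E)
    (hconvex : IsRandomUniformlyConvex P 𝕜 E)
    (G : Set E) (hGbdd : IsASBounded P 𝕜 G)
    (hGclosed : IsClosed[epsLamTopology P 𝕜 E] G)
    (hGconvex : IsL0Convex P 𝕜 G)
    (f : G → G) (hf : IsRandomAsymptoticallyNonexpansive P 𝕜 f) :
    IsRandomDemiclosedAtZero P 𝕜 (fun x : G => (x : E) - (f x : E)) := by
  intro u x hux huf
  obtain ⟨ξ, hξ⟩ := hGbdd
  obtain ⟨η, -, hη1, hη⟩ := hf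
  have hη' : ∀ m ≥ 1, ∀ a b : G, ∀ᵐ ω ∂P, rnorm P 𝕜 ((f^[m] a : E) - f^[m] b) ω ≤
      η m ω * rnorm P 𝕜 ((a : E) - b) ω := fun m hm a b => by
    filter_upwards [AEEqFun.coeFn_le.2 (hη m hm a b),
      AEEqFun.coeFn_mul (η m) (rnorm P 𝕜 ((a : E) - b))] with ω h1 h2
    rwa [h2] at h1
  have local_demiclosed : ∀ τ : ℝ, 0 < τ → ∃ A, MeasurableSet A ∧ P.real Aᶜ ≤ τ ∧
      (∀ τ : ℝ, 0 < τ → ∃ y : G, ∃ z : L2Space P 𝕜 E A, z.1 = y - x ∧ ‖z‖ ≤ τ) ∧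
      ∀ hx : x ∈ G, ∀ᵐ ω ∂P.restrict A, rnorm P 𝕜 ((f ⟨x, hx⟩ : E) - x) ω = 0 := by
    intro τ hτ
    have hb : Measurable fun ω => |ξ ω| + |rnorm P 𝕜 x ω| + |η 1 ω| :=
      (ξ.measurable.abs.add (rnorm P 𝕜 x).measurable.abs).add (η 1).measurable.abs
    obtain ⟨A, hA, hPA, ⟨N, hN⟩, hu⟩ :=
      exists_measurableSet_bounded_tendstoUniformlyOn hb hη1 hτ
    have hN' : ∀ ω ∈ A, |ξ ω| + |rnorm P 𝕜 x ω| + |η 1 ω| ≤ max N 0 := fun ω hω =>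
      (hN ω hω).trans (le_max_left _ _)
    refine ⟨A, hA, hPA, demiclosed_on hconvex hGconvex hA (le_max_right N 0) ?_ ?_ ?_ ?_ hux huf⟩
    · intro y hy
      filter_upwards [ae_restrict_of_ae (AEEqFun.coeFn_le.2 (hξ ⟨y, hy, rfl⟩)),
        ae_restrict_mem hA] with ω h1 h2
      linarith [hN' ω h2, le_abs_self (ξ ω), abs_nonneg (rnorm P 𝕜 x ω), abs_nonneg (η 1 ω)]
    · intro a b
      filter_upwards [ae_restrict_of_ae (hη' 1 le_rfl a b), ae_restrict_mem hA,
        ae_restrict_of_ae (ae_rnorm_nonneg P 𝕜 ((a : E) - b))] with ω h1 h2 h3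
      refine h1.trans (mul_le_mul_of_nonneg_right ?_ h3)
      linarith [hN' ω h2, le_abs_self (η 1 ω), abs_nonneg (rnorm P 𝕜 x ω), abs_nonneg (ξ ω)]
    · intro ρ hρ
      obtain ⟨m₀, hm₀⟩ := eventually_atTop.1 (Metric.tendstoUniformlyOn_iff.1 hu ρ hρ)
      refine ⟨max m₀ 1, fun m hm a b => ?_⟩
      filter_upwards [ae_restrict_of_ae (hη' m (le_of_max_le_right hm) a b), ae_restrict_mem hA,
        ae_restrict_of_ae (ae_rnorm_nonneg P 𝕜 ((a : E) - b))] with ω h1 h2 h3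
      refine h1.trans (mul_le_mul_of_nonneg_right ?_ h3)
      have h4 := hm₀ m (le_of_max_le_left hm) ω h2
      rw [Real.dist_eq, abs_lt] at h4
      linarith
    · filter_upwards [ae_restrict_mem hA] with ω h2
      linarith [hN' ω h2, le_abs_self (rnorm P 𝕜 x ω), abs_nonneg (ξ ω), abs_nonneg (η 1 ω)]
  have hx : x ∈ G := by
    refine mem_of_isClosed_epsLam hGclosed fun ε hε => ?_
    obtain ⟨A, hA, hPA, h, -⟩ := local_demiclosed (ε / 2) (half_pos hε)
    obtain ⟨y, z, hz, hzn⟩ := h (√(ε ^ 2 * (ε / 2))) (by positivity)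
    refine ⟨y, y.2, ?_⟩
    have h1 := z.measure_le hA hε
    have h2 : ‖z‖ ^ 2 / ε ^ 2 ≤ ε / 2 := by
      rw [div_le_iff₀ (by positivity), mul_comm (ε / 2)]
      calc ‖z‖ ^ 2 ≤ √(ε ^ 2 * (ε / 2)) ^ 2 := by gcongr
        _ = _ := Real.sq_sqrt (by positivity)
    rw [hz] at h1
    linarith
  refine ⟨hx, ?_⟩
  have hzero : P.real {ω | rnorm P 𝕜 ((f ⟨x, hx⟩ : E) - x) ω ≠ 0} = 0 := by
    refine le_antisymm (le_of_forall_pos_le_add fun τ hτ => ?_) measureReal_nonneg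
    obtain ⟨A, hA, hPA, -, h⟩ := local_demiclosed τ hτ
    rw [zero_add]
    refine le_trans (ENNReal.toReal_mono (measure_ne_top _ _) (measure_mono_ae ?_)) hPA
    filter_upwards [(ae_restrict_iff' hA).1 (h hx)] with ω h1 h2 h3
    exact h2 (h1 h3)
  rw [measureReal_eq_zero_iff] at hzero
  have hr : rnorm P 𝕜 ((f ⟨x, hx⟩ : E) - x) = 0 := by
    refine AEEqFun.ext ?_
    filter_upwards [measure_eq_zero_iff_ae_notMem.1 hzero,
      AEEqFun.coeFn_zero (μ := P) (β := ℝ)] with ω h1 h2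
    rw [h2]
    exact not_not.1 h1
  change x - (f ⟨x, hx⟩ : E) = 0
  rw [← neg_sub, RNModule.eq_zero_of_rnorm (P := P) (𝕜 := 𝕜) _ hr, neg_zero]
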